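/- Let $k\ge -\tfrac12$, let $d\mu_k(x)=\frac{|x|^{2k+1}}{2^{k+1}\Gamma(k+1)}\,dx$ and $L^2_k=L^2(\mathbb R,d\mu_k)$ (complex valued), and let $M=(a,b;c,d)\in SL(2,\mathbb R)$ with $b\ne 0$. The Dunkl operator is $\Lambda_k f(x)=f'(x)+\frac{2k+1}{x}\cdot\frac{f(x)-f(-x)}{2}$ and the linear canonical Dunkl operator is $\Lambda_{k,M}f(x)=\Lambda_kf(x)-i\frac db\,x f(x)$, so that $\Lambda_{k,M^{-1}}f(x)=\Lambda_kf(x)+i\frac ab\,xf(x)$. With $$j_k(x)=\Gamma(k+1)\sum_{n\ge0}\frac{(-1)^n(x/2)^{2n}}{n!\,\Gamma(n+k+1)},\qquad E_k(i\lambda,x)=j_k(\lambda x)+\frac{i\lambda x}{2(k+1)}\,j_{k+1}(\lambda x),$$ $$E_k^M(\lambda,x)=e^{\frac i2\left(\frac db\lambda^2+\frac ab x^2\right)}E_k(-i\lambda/b,x),$$ the linear canonical Dunkl transform is $\mathcal D_k^M f(\lambda)=\frac1{(ib)^{k+1}}\int_{\mathbb R} f(x)E_k^M(\lambda,x)\,d\mu_k(x)$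 (principal branch of the power). It is extended to tempered distributions by duality: $(\mathcal D_k^MT)(\varphi)=T(\psi)$ with $\psi(x)=\frac1{(ib)^{k+1}}\int_{\mathbb R}\varphi(\lambda)E_k^M(\lambda,x)\,d\mu_k(\lambda)$ for $\varphi\in\mathcal S(\mathbb R)$. A function $f$ (in particular $f\in L^2_k$) is identified with the distribution $\varphi\mapsto\int f\varphi\,d\mu_k$. For $f\in L^2_k$, $\Lambda_{k,M^{-1}}^nf\in L^2_k$ means that there is $g\in L^2_k$ (then $\Lambda^n_{k,M^{-1}}f:=g$) with $$\int_{\mathbb R} g\,\overline{\varphi}\,d\mu_k=(-1)^n\int_{\mathbb R} f\,\overline{\Lambda_{k,M^{-1}}^n\varphi}\,d\mu_k\qquad\text{for all }\varphi\in\mathcal S(\mathbb R).$$ For $s\in\mathbb R$ let $$\mathbf W^s_{k,M}(\mathbb R)=\{h\in\mathcal S'(\mathbb R):(1+|\lambda|^2)^{s/2}\,\mathcal D_k^M(h)\in L^2_k\},\qquad \|h\|^2_{\mathbf W^s_{k,M}}=\int_{\mathbb R}(1+|\lambda|^2)^s\,|\mathcal D_k^M(h)(\lambda)|^2\,d\mu_k(\lambda).$$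 **Proposition.** Let $m\ge 0$ be an integer. (i) For all $k$ and $M$ as above, $\mathbf W^m_{k,M}(\mathbb R)$ is equal to $$E_m=\{f\in L^2_k:\ \Lambda_{k,M^{-1}}^nf\in L^2_k\ \text{ for all } 0\le n\le m\}.$$ (ii) For every $b\neq0$ there are constants $c,C>0$, depending only on $m$ and $b$, such that for all $k\ge-\frac12$, all $M\in SL(2,\mathbb R)$ with upper right entry $b$, and all $f\in E_m$, $$c\sum_{n=0}^m\|\Lambda_{k,M^{-1}}^nf\|^2_{L^2_k}\ \le\ \|f\|^2_{\mathbf W^m_{k,M}}\ \le\ C\sum_{n=0}^m\|\Lambda_{k,M^{-1}}^nf\|^2_{L^2_k}.$$ -/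

import Mathlib

open MeasureTheory
open scoped SchwartzMap ComplexConjugate

namespace LCDunkl

noncomputable section

/-- The measure `dμ_k(x) = |x|^(2k+1) dx / (2^(k+1) Γ(k+1))` on the real line. -/
def dunklMeasure (k : ℝ) : Measure ℝ :=
  volume.withDensity fun x =>
    ENNReal.ofReal (|x| ^ (2 * k + 1) / (2 ^ (k + 1) * Real.Gamma (k + 1)))

/-- The weighted space `L²_k(ℝ)` of complex-valued functions. -/
abbrev L2k (k : ℝ) : Type := Lp ℂ 2 (dunklMeasure k)

theorem dunklMeasure_hasTemperateGrowth {k : ℝ} (hk : -1 / 2 ≤ k) :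
    (dunklMeasure k).HasTemperateGrowth := by
  have hG : 0 < 2 ^ (k + 1) * Real.Gamma (k + 1) :=
    mul_pos (Real.rpow_pos_of_pos (by norm_num) _) (Real.Gamma_pos_of_pos (by linarith))
  obtain ⟨n, hn⟩ := exists_nat_gt (2 * k + 3)
  have hmeas : Measurable fun x : ℝ =>
      |x| ^ (2 * k + 1) / (2 ^ (k + 1) * Real.Gamma (k + 1)) := by fun_prop
  refine ⟨⟨n, ?_⟩⟩
  unfold dunklMeasure
  rw [integrable_withDensity_iff_integrable_smul' (by fun_prop)
    (Filter.Eventually.of_forall fun x => ENNReal.ofReal_lt_top)]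
  have hint : Integrable (fun x : ℝ => (1 + ‖x‖) ^ (-((n : ℝ) - (2 * k + 1)))) volume :=
    integrable_one_add_norm (by simp; linarith)
  refine (hint.mul_const (2 ^ (k + 1) * Real.Gamma (k + 1))⁻¹).mono' ?_
    (Filter.Eventually.of_forall fun x => ?_)
  · exact Measurable.aestronglyMeasurable (by fun_prop)
  · have h1 : (0 : ℝ) < 1 + ‖x‖ := by positivity
    rw [ENNReal.toReal_ofReal (by positivity), smul_eq_mul, Real.norm_of_nonneg (by positivity),
      neg_sub, sub_eq_add_neg, Real.rpow_add h1, div_eq_mul_inv]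
    have h2 : |x| ^ (2 * k + 1) ≤ (1 + ‖x‖) ^ (2 * k + 1) :=
      Real.rpow_le_rpow (abs_nonneg x) (by simp) (by linarith)
    have h3 : 0 ≤ (1 + ‖x‖) ^ (-(n : ℝ)) := by positivity
    have h4 : 0 ≤ (2 ^ (k + 1) * Real.Gamma (k + 1))⁻¹ := by positivity
    nlinarith [mul_le_mul_of_nonneg_right h2 (mul_nonneg h3 h4)]

/-- The inclusion `L²_k(ℝ) ⊂ 𝓢'(ℝ)`: the function `f` acts by `φ ↦ ∫ φ f dμ_k`. -/
def toDist {k : ℝ} (hk : -1 / 2 ≤ k) (f : L2k k) : 𝓢'(ℝ, ℂ) :=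
  haveI := dunklMeasure_hasTemperateGrowth hk
  Lp.toTemperedDistribution f

theorem toDist_apply {k : ℝ} (hk : -1 / 2 ≤ k) (f : L2k k) (φ : 𝓢(ℝ, ℂ)) :
    toDist hk f φ = ∫ x, φ x * f x ∂(dunklMeasure k) :=
  haveI := dunklMeasure_hasTemperateGrowth hk
  Lp.toTemperedDistribution_apply f φ

/-! ### The Dunkl operator and the linear canonical Dunkl operator -/

/-- The Dunkl operator `Λ_k f(x) = f'(x) + (2k+1)/x * (f(x) - f(-x))/2`. The term
`dslope f (-x) x` is `(f(x) - f(-x))/(2x)` for `x ≠ 0` and its continuous extension `f'(0)`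
at `x = 0`. -/
def dunklOp (k : ℝ) (f : ℝ → ℂ) (x : ℝ) : ℂ :=
  deriv f x + (2 * k + 1) * dslope f (-x) x

/-- The linear canonical Dunkl operator `Λ_{k,M} f(x) = Λ_k f(x) - i (d/b) x f(x)`,
for `M = (a, b; c, d)`. -/
def lcDunklOp (k : ℝ) (M : Matrix.SpecialLinearGroup (Fin 2) ℝ) (f : ℝ → ℂ) (x : ℝ) : ℂ :=
  dunklOp k f x - Complex.I * ((M 1 1 / M 0 1 : ℝ) : ℂ) * x * f x

/-- `g = Λ_{k,M}^n f` in the sense of distributions, for `f, g ∈ L²_k`. On Schwartz functions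
`Λ_{k,M}` is skew-symmetric for the inner product of `L²_k`, so that `Λ_{k,M}^n f` is the
functional `φ ↦ (-1)^n ⟨f, Λ_{k,M}^n φ⟩`. -/
def IsWeakPow (k : ℝ) (M : Matrix.SpecialLinearGroup (Fin 2) ℝ) (n : ℕ) (f g : L2k k) : Prop :=
  ∀ φ : 𝓢(ℝ, ℂ), ∫ x, g x * conj (φ x) ∂(dunklMeasure k) =
    (-1) ^ n * ∫ x, f x * conj ((lcDunklOp k M)^[n] φ x) ∂(dunklMeasure k)

open Classical in
/-- `Λ_{k,M}^n f`, if it belongs to `L²_k` (and `0` otherwise). -/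
def weakPow (k : ℝ) (M : Matrix.SpecialLinearGroup (Fin 2) ℝ) (n : ℕ) (f : L2k k) : L2k k :=
  if h : ∃ g, IsWeakPow k M n f g then h.choose else 0

/-- `E_m = {f ∈ L²_k : Λ_{k,M⁻¹}^n f ∈ L²_k for all n ≤ m}`. -/
def spaceE (k : ℝ) (M : Matrix.SpecialLinearGroup (Fin 2) ℝ) (m : ℕ) : Set (L2k k) :=
  {f | ∀ n ≤ m, ∃ g, IsWeakPow k M⁻¹ n f g}

/-! ### The linear canonical Dunkl transform -/

/-- The normalized spherical Bessel function `j_k`. -/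
def besselJ (k x : ℝ) : ℝ :=
  Real.Gamma (k + 1) *
    ∑' n : ℕ, (-1) ^ n * (x / 2) ^ (2 * n) / (n.factorial * Real.Gamma (n + k + 1))

/-- The Dunkl kernel: `dunklKernel k l x` is `E_k(i l, x)`. -/
def dunklKernel (k l x : ℝ) : ℂ :=
  besselJ k (l * x) + Complex.I * l * x / (2 * (k + 1)) * besselJ (k + 1) (l * x)

/-- The kernel `E_k^M(l, x) = exp((i/2) ((d/b) l² + (a/b) x²)) E_k(-i l/b, x)`. -/
def lcKernel (k : ℝ) (M : Matrix.SpecialLinearGroup (Fin 2) ℝ) (l x : ℝ) : ℂ :=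
  Complex.exp (Complex.I / 2 * ((M 1 1 / M 0 1 * l ^ 2 + M 0 0 / M 0 1 * x ^ 2 : ℝ) : ℂ)) *
    dunklKernel k (-l / M 0 1) x

/-- The linear canonical Dunkl transform
`D_k^M f(l) = (ib)^(-(k+1)) ∫ f(x) E_k^M(l, x) dμ_k(x)` of an integrable function. -/
def lcdt (k : ℝ) (M : Matrix.SpecialLinearGroup (Fin 2) ℝ) (f : ℝ → ℂ) (l : ℝ) : ℂ :=
  1 / (Complex.I * M 0 1) ^ ((k + 1 : ℝ) : ℂ) *
    ∫ x, f x * lcKernel k M l x ∂(dunklMeasure k)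

/-- The transpose of `lcdt`, i.e. the integral operator with the two variables of the kernel
exchanged: `∫ (lcdt k M f) φ dμ_k = ∫ f (lcdtTranspose k M φ) dμ_k`. -/
def lcdtTranspose (k : ℝ) (M : Matrix.SpecialLinearGroup (Fin 2) ℝ) (φ : ℝ → ℂ) (x : ℝ) : ℂ :=
  1 / (Complex.I * M 0 1) ^ ((k + 1 : ℝ) : ℂ) *
    ∫ l, φ l * lcKernel k M l x ∂(dunklMeasure k)

/-- The tempered distribution `U` is the linear canonical Dunkl transform of the tempered
distribution `T`, defined by duality: for every Schwartz function `φ` the transposed transform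
`ψ` of `φ` is a Schwartz function, and `U(φ) = T(ψ)`. -/
def IsLCDT (k : ℝ) (M : Matrix.SpecialLinearGroup (Fin 2) ℝ) (T U : 𝓢'(ℝ, ℂ)) : Prop :=
  ∀ φ : 𝓢(ℝ, ℂ), ∃ ψ : 𝓢(ℝ, ℂ), (∀ x, ψ x = lcdtTranspose k M φ x) ∧ U φ = T ψ

/-- The tempered distribution `U` is the function `g`, i.e. `U(φ) = ∫ φ g dμ_k`. -/
def IsFunction (k : ℝ) (U : 𝓢'(ℝ, ℂ)) (g : ℝ → ℂ) : Prop :=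
  ∀ φ : 𝓢(ℝ, ℂ), Integrable (fun l => φ l * g l) (dunklMeasure k) ∧
    U φ = ∫ l, φ l * g l ∂(dunklMeasure k)

/-- The linear canonical Dunkl transform of `T` is the function `g`. -/
def HasLCDT (k : ℝ) (M : Matrix.SpecialLinearGroup (Fin 2) ℝ) (T : 𝓢'(ℝ, ℂ)) (g : ℝ → ℂ) :
    Prop :=
  ∃ U, IsLCDT k M T U ∧ IsFunction k U g

open Classical in
/-- The linear canonical Dunkl transform of `T`, if it is a function (and `0` otherwise). -/
def lcdtFun (k : ℝ) (M : Matrix.SpecialLinearGroup (Fin 2) ℝ) (T : 𝓢'(ℝ, ℂ)) : ℝ → ℂ :=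
  if h : ∃ g, HasLCDT k M T g then h.choose else 0

/-! ### The linear canonical Dunkl Sobolev spaces -/

/-- `W^s_{k,M}(ℝ) = {T ∈ 𝓢'(ℝ) : (1 + l²)^(s/2) D_k^M(T) ∈ L²_k}`. -/
def sobolevSpace (k : ℝ) (M : Matrix.SpecialLinearGroup (Fin 2) ℝ) (s : ℝ) : Set 𝓢'(ℝ, ℂ) :=
  {T | ∃ g, HasLCDT k M T g ∧
    MemLp (fun l : ℝ => (((1 + |l| ^ 2) ^ (s / 2) : ℝ) : ℂ) * g l) 2 (dunklMeasure k)}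

/-- The inner product of `W^s_{k,M}(ℝ)`. -/
def sobolevInner (k : ℝ) (M : Matrix.SpecialLinearGroup (Fin 2) ℝ) (s : ℝ)
    (T₁ T₂ : 𝓢'(ℝ, ℂ)) : ℂ :=
  ∫ l : ℝ, (((1 + |l| ^ 2) ^ s : ℝ) : ℂ) * lcdtFun k M T₁ l * conj (lcdtFun k M T₂ l)
    ∂(dunklMeasure k)

/-- The norm of `W^s_{k,M}(ℝ)`. -/
def sobolevNorm (k : ℝ) (M : Matrix.SpecialLinearGroup (Fin 2) ℝ) (s : ℝ)
    (T : 𝓢'(ℝ, ℂ)) : ℝ :=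
  √(sobolevInner k M s T T).re

end

end LCDunkl

namespace LCDunkl

noncomputable section

/-! ### Recognizing Schwartz functions -/

/-! The transform turns $\Lambda_{k,M^{-1}}$ into multiplication by $ix/b$ and is unitary on
$L^2_k$. Writing $F$ for the transform of $f$, both sides of the comparison become weighted
integrals of $|F|^2$: the Sobolev norm has weight $(1+x^2)^m$, the sum of the
$\|\Lambda^n_{k,M^{-1}}f\|^2$ has weight $\sum_{n\le m}(x/b)^{2n}$. These weights are comparable
with constants depending only on $m$ and $b$, which gives (ii) and, through finiteness of the
integrals, (i).

Since $M^{-1}=(d,-b;-c,a)$, conjugation by the chirp $e^{iax^2/2b}$ turns $\Lambda_{k,M^{-1}}$ into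
$\Lambda_k$, and the transform is the Dunkl transform composed with two chirps, a dilation and a
constant (`lcdt_eq`, `chirp_mul_lcDunklOp`). Hence everything rests on the Dunkl transform on
Schwartz functions. The kernel is bounded by $1$ by an energy argument (`besselJ_sq_add_le_one`);
the exchange of $\Lambda_k$ with multiplication comes from integration by parts
(`integral_dunklOp_mul`) and differentiation under the integral; Schwartz functions are preserved
(`IsSchwartz.dunklTransform`); inversion follows algebraically from these rules and the invariance
of the Gaussian (`dunklTransform_dunklTransform`). Inversion and Fubini give Plancherel.

Density extends the transform to a unitary map `lcL2` of $L^2_k$. It agrees with the distributional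
transform (`hasLCDT_toDist`), every distribution whose transform lies in $L^2_k$ arises from it
(`HasLCDT.eq_toDist`), and weak powers become multiplication by $(ix/b)^n$ (`isWeakPow_iff`). -/

/-- `f` is (the underlying function of) a Schwartz function. -/
def IsSchwartz (f : ℝ → ℂ) : Prop := ∃ φ : 𝓢(ℝ, ℂ), ⇑φ = f

/-- A class of bounded differentiable functions that is closed under differentiation and under
multiplication by the variable consists of Schwartz functions. -/
theorem isSchwartz_of_class (S : Set (ℝ → ℂ))
    (hdiff : ∀ f ∈ S, Differentiable ℝ f) (hderiv : ∀ f ∈ S, deriv f ∈ S)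
    (hmul : ∀ f ∈ S, (fun x : ℝ => (x : ℂ) * f x) ∈ S)
    (hbdd : ∀ f ∈ S, ∃ C : ℝ, ∀ x, ‖f x‖ ≤ C) {f : ℝ → ℂ} (hf : f ∈ S) : IsSchwartz f := by
  have hit : ∀ n : ℕ, iteratedDeriv n f ∈ S := by
    intro n
    induction n with
    | zero => simpa using hf
    | succ n ih => rw [iteratedDeriv_succ]; exact hderiv _ ih
  have hpow : ∀ (k : ℕ) (g : ℝ → ℂ), g ∈ S → (fun x : ℝ => (x : ℂ) ^ k * g x) ∈ S := by
    intro k g hg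
    induction k with
    | zero => simpa using hg
    | succ k ih =>
      convert! hmul _ ih using 2 with x
      ring
  refine ⟨⟨f, contDiff_of_differentiable_iteratedDeriv fun n _ => hdiff _ (hit n), fun k n => ?_⟩,
    rfl⟩
  obtain ⟨C, hC⟩ := hbdd _ (hpow k _ (hit n))
  refine ⟨C, fun x => ?_⟩
  rw [norm_iteratedFDeriv_eq_norm_iteratedDeriv]
  simpa using hC x

namespace IsSchwartz

variable {f g : ℝ → ℂ}

theorem of_coe (φ : 𝓢(ℝ, ℂ)) : IsSchwartz φ := ⟨φ, rfl⟩

theorem differentiable (hf : IsSchwartz f) : Differentiable ℝ f := by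
  obtain ⟨φ, rfl⟩ := hf
  exact φ.differentiable

theorem continuous (hf : IsSchwartz f) : Continuous f := hf.differentiable.continuous

theorem hasDerivAt (hf : IsSchwartz f) (x : ℝ) : HasDerivAt f (deriv f x) x :=
  (hf.differentiable x).hasDerivAt

theorem exists_norm_le (hf : IsSchwartz f) : ∃ C : ℝ, ∀ x, ‖f x‖ ≤ C := by
  obtain ⟨φ, rfl⟩ := hf
  exact ⟨_, φ.norm_le_seminorm ℝ⟩

theorem add (hf : IsSchwartz f) (hg : IsSchwartz g) : IsSchwartz fun x => f x + g x := by
  obtain ⟨φ, rfl⟩ := hf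
  obtain ⟨ψ, rfl⟩ := hg
  exact ⟨φ + ψ, rfl⟩

theorem const_mul (c : ℂ) (hf : IsSchwartz f) : IsSchwartz fun x => c * f x := by
  obtain ⟨φ, rfl⟩ := hf
  exact ⟨c • φ, rfl⟩

theorem sub (hf : IsSchwartz f) (hg : IsSchwartz g) : IsSchwartz fun x => f x - g x := by
  simpa [sub_eq_add_neg] using hf.add (hg.const_mul (-1))

theorem deriv (hf : IsSchwartz f) : IsSchwartz (deriv f) := by
  obtain ⟨φ, rfl⟩ := hf
  exact ⟨SchwartzMap.derivCLM ℝ ℂ φ, funext fun x => SchwartzMap.derivCLM_apply ℝ φ x⟩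

theorem id_mul (hf : IsSchwartz f) : IsSchwartz fun x : ℝ => (x : ℂ) * f x := by
  obtain ⟨φ, rfl⟩ := hf
  refine ⟨SchwartzMap.smulLeftCLM ℂ (fun x : ℝ => (x : ℂ)) φ, funext fun x => ?_⟩
  rw [SchwartzMap.smulLeftCLM_apply_apply Function.Complex.hasTemperateGrowth_ofReal]
  simp

theorem comp_mul_left (hf : IsSchwartz f) {c : ℝ} (hc : c ≠ 0) :
    IsSchwartz fun x => f (c * x) := by
  obtain ⟨φ, rfl⟩ := hf
  exact ⟨SchwartzMap.compCLMOfContinuousLinearEquiv ℝ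
    (ContinuousLinearEquiv.unitsEquivAut ℝ (Units.mk0 c hc)) φ, funext fun x => by
      simp [mul_comm]⟩

theorem comp_neg (hf : IsSchwartz f) : IsSchwartz fun x => f (-x) := by
  simpa using hf.comp_mul_left (c := -1) (by norm_num)

theorem star (hf : IsSchwartz f) : IsSchwartz fun x => conj (f x) := by
  obtain ⟨φ, rfl⟩ := hf
  exact ⟨SchwartzMap.postcompCLM (𝕜 := ℝ) Complex.conjCLE.toContinuousLinearMap φ,
    funext fun x => by simp⟩

end IsSchwartz

/-! ### Chirps -/

/-- The chirp `x ↦ exp (i a x² / 2)`. -/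
def chirp (a x : ℝ) : ℂ := Complex.exp (Complex.I / 2 * ((a * x ^ 2 : ℝ) : ℂ))

theorem norm_chirp (a x : ℝ) : ‖chirp a x‖ = 1 := by
  rw [chirp, show Complex.I / 2 * ((a * x ^ 2 : ℝ) : ℂ) = ((a * x ^ 2 / 2 : ℝ) : ℂ) * Complex.I by
    push_cast; ring, Complex.norm_exp_ofReal_mul_I]

theorem chirp_neg_mul_chirp (a x : ℝ) : chirp (-a) x * chirp a x = 1 := by
  rw [chirp, chirp, ← Complex.exp_add]
  simp

theorem chirp_apply_neg (a x : ℝ) : chirp a (-x) = chirp a x := by simp [chirp]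

theorem conj_chirp (a x : ℝ) : conj (chirp a x) = chirp (-a) x := by
  rw [chirp, chirp, ← Complex.exp_conj]
  simp [Complex.conj_ofNat]
  ring_nf

theorem hasDerivAt_chirp (a x : ℝ) :
    HasDerivAt (chirp a) (Complex.I * a * x * chirp a x) x := by
  have h : HasDerivAt (fun x : ℝ => Complex.I / 2 * ((a * x ^ 2 : ℝ) : ℂ))
      (Complex.I / 2 * ((a * (2 * x) : ℝ) : ℂ)) x := by
    refine (HasDerivAt.ofReal_comp ?_).const_mul _
    simpa using (hasDerivAt_pow 2 x).const_mul a
  convert! h.cexp using 1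
  rw [chirp]
  push_cast
  ring

/-- The derivative of a chirp times $g$ is the same chirp times $iaxg+g'$, so chirp multiples of
Schwartz functions form a stable class; boundedness holds because a chirp has modulus $1$. -/
theorem IsSchwartz.chirp_mul {f : ℝ → ℂ} (hf : IsSchwartz f) (a : ℝ) :
    IsSchwartz fun x => chirp a x * f x := by
  refine isSchwartz_of_class {h | ∃ g, IsSchwartz g ∧ h = fun x => chirp a x * g x}
    ?_ ?_ ?_ ?_ ⟨f, hf, rfl⟩
  · rintro _ ⟨g, hg, rfl⟩ x
    exact ((hasDerivAt_chirp a x).mul (hg.hasDerivAt x)).differentiableAt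
  · rintro _ ⟨g, hg, rfl⟩
    refine ⟨_, (hg.id_mul.const_mul (Complex.I * a)).add hg.deriv, funext fun x => ?_⟩
    rw [((hasDerivAt_chirp a x).fun_mul (hg.hasDerivAt x)).deriv]
    ring
  · rintro _ ⟨g, hg, rfl⟩
    exact ⟨_, hg.id_mul, funext fun x => by ring⟩
  · rintro _ ⟨g, hg, rfl⟩
    obtain ⟨C, hC⟩ := hg.exists_norm_le
    exact ⟨C, fun x => by simpa [norm_chirp] using hC x⟩

/-! ### Division of Schwartz functions by linear functions -/

/-- `∫₀¹ tⁿ f(a + t (x - a)) dt`. -/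
def segmentMean (a : ℝ) (n : ℕ) (f : ℝ → ℂ) (x : ℝ) : ℂ :=
  ∫ t in (0 : ℝ)..1, (t : ℂ) ^ n * f (a + t * (x - a))

theorem hasDerivAt_segmentMean (a : ℝ) (n : ℕ) {f : ℝ → ℂ} (hf : IsSchwartz f) (x : ℝ) :
    HasDerivAt (segmentMean a n f) (segmentMean a (n + 1) (deriv f) x) x := by
  obtain ⟨C, hC⟩ := hf.deriv.exists_norm_le
  have hc := hf.continuous
  have hc' := hf.deriv.continuous
  refine (intervalIntegral.hasDerivAt_integral_of_dominated_loc_of_deriv_le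
    (F := fun x t => (t : ℂ) ^ n * f (a + t * (x - a)))
    (F' := fun x t => (t : ℂ) ^ (n + 1) * deriv f (a + t * (x - a))) (bound := fun _ => C)
    Filter.univ_mem ?_ ?_ ?_ ?_ ?_ ?_).2
  · exact Filter.Eventually.of_forall fun y => Continuous.aestronglyMeasurable (by fun_prop)
  · exact Continuous.intervalIntegrable (by fun_prop) _ _
  · exact Continuous.aestronglyMeasurable (by fun_prop)
  · refine Filter.Eventually.of_forall fun t ht y _ => ?_
    rw [Set.uIoc_of_le zero_le_one] at ht
    rw [norm_mul, norm_pow, Complex.norm_real, Real.norm_of_nonneg ht.1.le]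
    calc t ^ (n + 1) * ‖deriv f (a + t * (y - a))‖ ≤ 1 * ‖deriv f (a + t * (y - a))‖ := by
          gcongr
          exact pow_le_one₀ ht.1.le ht.2
      _ ≤ C := by simpa using hC _
  · exact intervalIntegrable_const
  · refine Filter.Eventually.of_forall fun t ht y _ => ?_
    have h1 : HasDerivAt (fun y : ℝ => a + t * (y - a)) t y := by
      simpa using (((hasDerivAt_id y).sub_const a).const_mul t).const_add a
    have h2 := ((hf.hasDerivAt (a + t * (y - a))).scomp y h1).const_mul ((t : ℂ) ^ n)
    convert! h2 using 1
    simp [Complex.real_smul]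
    ring

/-- The fundamental theorem of calculus on the segment from $a$ to $x$ (Hadamard's lemma). It
represents the difference quotient by an integral that is visibly smooth at $x=a$ too. -/
theorem sub_mul_segmentMean_zero (a : ℝ) {f : ℝ → ℂ} (hf : IsSchwartz f) (x : ℝ) :
    ((x - a : ℝ) : ℂ) * segmentMean a 0 (deriv f) x = f x - f a := by
  have hc := hf.deriv.continuous
  have h : ∀ t ∈ Set.uIcc (0 : ℝ) 1, HasDerivAt (fun t : ℝ => f (a + t * (x - a)))
      (((x - a : ℝ) : ℂ) * deriv f (a + t * (x - a))) t := by
    intro t _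
    have h1 : HasDerivAt (fun t : ℝ => a + t * (x - a)) (x - a) t := by
      simpa using ((hasDerivAt_id t).mul_const (x - a)).const_add a
    simpa [Complex.real_smul] using! (hf.hasDerivAt (a + t * (x - a))).scomp t h1
  have h2 := intervalIntegral.integral_eq_sub_of_hasDerivAt h
    (Continuous.intervalIntegrable (by fun_prop) _ _)
  rw [intervalIntegral.integral_const_mul] at h2
  simpa [segmentMean] using h2

theorem iteratedDeriv_isSchwartz {f : ℝ → ℂ} (hf : IsSchwartz f) (n : ℕ) :
    IsSchwartz (iteratedDeriv n f) := by
  induction n with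
  | zero => simpa using hf
  | succ n ih => rw [iteratedDeriv_succ]; exact ih.deriv

theorem iteratedDeriv_segmentMean (a : ℝ) {f : ℝ → ℂ} (hf : IsSchwartz f) (n : ℕ) :
    iteratedDeriv n (segmentMean a 0 (deriv f)) = segmentMean a n (iteratedDeriv (n + 1) f) := by
  induction n with
  | zero => simp [iteratedDeriv_one]
  | succ n ih =>
    rw [iteratedDeriv_succ, ih]
    ext x
    rw [(hasDerivAt_segmentMean a n (iteratedDeriv_isSchwartz hf _) x).deriv,
      ← iteratedDeriv_succ]

theorem contDiff_segmentMean (a : ℝ) {f : ℝ → ℂ} (hf : IsSchwartz f) :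
    ContDiff ℝ (⊤ : ℕ∞) (segmentMean a 0 (deriv f)) := by
  refine contDiff_of_differentiable_iteratedDeriv fun n _ x => ?_
  rw [iteratedDeriv_segmentMean a hf]
  exact (hasDerivAt_segmentMean a n (iteratedDeriv_isSchwartz hf _) x).differentiableAt

theorem IsSchwartz.sub_mul {f : ℝ → ℂ} (hf : IsSchwartz f) (a : ℝ) :
    IsSchwartz fun x => ((x - a : ℝ) : ℂ) * f x := by
  convert! hf.id_mul.sub (hf.const_mul a) using 2 with x
  push_cast
  ring

/-- Division by $x-a$ costs nothing where $|x-a|\ge1$, and continuity on a compact interval bounds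
the rest. The class admits every power $(x-a)^n$ because each derivative uses up one more factor:
$(x-a)^{n+1}g'=((x-a)^{n+1}g)'-(n+1)(x-a)^ng$. -/
theorem isSchwartz_of_sub_mul (a : ℝ) {g : ℝ → ℂ} (hg : ContDiff ℝ (⊤ : ℕ∞) g)
    (h : IsSchwartz fun x => ((x - a : ℝ) : ℂ) * g x) : IsSchwartz g := by
  refine isSchwartz_of_class {g | ContDiff ℝ (⊤ : ℕ∞) g ∧
    ∃ n : ℕ, IsSchwartz fun x => ((x - a : ℝ) : ℂ) ^ n * g x} ?_ ?_ ?_ ?_ ⟨hg, 1, by simpa using h⟩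
  · exact fun g hg => hg.1.differentiable (by simp)
  · rintro g ⟨hg, n, hn⟩
    refine ⟨(contDiff_infty_iff_deriv.1 hg).2, n + 1, ?_⟩
    convert! (hn.sub_mul a).deriv.sub (hn.const_mul (n + 1)) using 2 with x
    have h1 : HasDerivAt (fun x : ℝ => ((x - a : ℝ) : ℂ)) 1 x := by
      simpa using ((hasDerivAt_id x).sub_const a).ofReal_comp
    have h2 : HasDerivAt g (deriv g x) x := (hg.differentiable (by simp) x).hasDerivAt
    have h3 := (h1.pow (n + 1)).mul h2
    have h4 : (fun x : ℝ => ((x - a : ℝ) : ℂ) * (((x - a : ℝ) : ℂ) ^ n * g x)) =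
        (fun x : ℝ => ((x - a : ℝ) : ℂ)) ^ (n + 1) * g := by
      ext x
      simp only [Pi.mul_apply, Pi.pow_apply]
      ring
    rw [h4, h3.deriv]
    simp
    ring
  · rintro g ⟨hg, n, hn⟩
    refine ⟨Complex.ofRealCLM.contDiff.mul hg, n, ?_⟩
    convert! hn.id_mul using 2 with x
    ring
  · rintro g ⟨hg, n, hn⟩
    obtain ⟨C, hC⟩ := hn.exists_norm_le
    obtain ⟨D, hD⟩ := (isCompact_Icc (a := a - 1) (b := a + 1)).exists_bound_of_continuousOn
      hg.continuous.continuousOn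
    refine ⟨max C D, fun x => ?_⟩
    by_cases hx : x ∈ Set.Icc (a - 1) (a + 1)
    · exact (hD x hx).trans (le_max_right _ _)
    · have h1 : 1 ≤ |x - a| := by
        by_contra! h
        rw [abs_lt] at h
        exact hx ⟨by linarith, by linarith⟩
      refine le_trans ?_ ((hC x).trans (le_max_left _ _))
      rw [norm_mul, norm_pow, Complex.norm_real, Real.norm_eq_abs]
      exact le_mul_of_one_le_left (norm_nonneg _) (one_le_pow₀ h1)

theorem IsSchwartz.dslope {f : ℝ → ℂ} (hf : IsSchwartz f) {a : ℝ} (ha : f a = 0) :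
    IsSchwartz (_root_.dslope f a) := by
  have h : _root_.dslope f a = segmentMean a 0 (_root_.deriv f) := by
    ext x
    rcases eq_or_ne x a with rfl | hx
    · simp [segmentMean]
    · have hx' : ((x - a : ℝ) : ℂ) ≠ 0 := by exact_mod_cast sub_ne_zero.2 hx
      rw [dslope_of_ne _ hx, slope_def_module, Complex.real_smul, Complex.ofReal_inv,
        ← sub_mul_segmentMean_zero a hf, inv_mul_cancel_left₀ hx']
  rw [h]
  refine isSchwartz_of_sub_mul a (contDiff_segmentMean a hf) ?_
  convert! hf using 2 with x
  rw [sub_mul_segmentMean_zero a hf, ha, sub_zero]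

/-! ### The Dunkl operators on Schwartz functions -/

/-- The function `(f(x) - f(-x)) / 2x`. -/
def oddQuotient (f : ℝ → ℂ) (x : ℝ) : ℂ := dslope f (-x) x

theorem dunklOp_apply (k : ℝ) (f : ℝ → ℂ) (x : ℝ) :
    dunklOp k f x = deriv f x + (2 * k + 1) * oddQuotient f x := rfl

theorem oddQuotient_of_ne (f : ℝ → ℂ) {x : ℝ} (hx : x ≠ 0) :
    oddQuotient f x = (f x - f (-x)) / (2 * x) := by
  have h : x ≠ -x := fun h => hx (by linarith)
  rw [oddQuotient, dslope_of_ne _ h, slope_def_module, Complex.real_smul]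
  push_cast
  ring

theorem oddQuotient_zero (f : ℝ → ℂ) : oddQuotient f 0 = deriv f 0 := by simp [oddQuotient]

theorem two_mul_oddQuotient (f : ℝ → ℂ) (x : ℝ) :
    2 * x * oddQuotient f x = f x - f (-x) := by
  rcases eq_or_ne x 0 with rfl | hx
  · simp
  · have : (x : ℂ) ≠ 0 := by exact_mod_cast hx
    rw [oddQuotient_of_ne f hx]
    field_simp

theorem oddQuotient_neg (f : ℝ → ℂ) (x : ℝ) : oddQuotient f (-x) = oddQuotient f x := by
  rcases eq_or_ne x 0 with rfl | hx
  · simp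
  · rw [oddQuotient_of_ne f hx, oddQuotient_of_ne f (neg_ne_zero.2 hx), neg_neg]
    push_cast
    rw [mul_neg, div_neg, ← neg_div, neg_sub]

/-- The quotient is the slope at $0$ of the odd part of $f$, which vanishes there. -/
theorem IsSchwartz.oddQuotient {f : ℝ → ℂ} (hf : IsSchwartz f) : IsSchwartz (oddQuotient f) := by
  have h1 : IsSchwartz fun x => (1 / 2 : ℂ) * (f x - f (-x)) := (hf.sub hf.comp_neg).const_mul _
  convert! h1.dslope (a := 0) (by simp) using 1
  ext x
  rcases eq_or_ne x 0 with rfl | hx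
  · have h2 : HasDerivAt (fun x => f (-x)) (-_root_.deriv f 0) 0 := by
      have := (hf.hasDerivAt (-0)).scomp (0 : ℝ) (hasDerivAt_neg (0 : ℝ))
      simpa using! this
    rw [oddQuotient_zero, dslope_same, (((hf.hasDerivAt 0).fun_sub h2).const_mul (1 / 2 : ℂ)).deriv]
    ring
  · rw [oddQuotient_of_ne f hx, dslope_of_ne _ hx, slope_def_module, Complex.real_smul]
    push_cast
    simp
    ring

theorem IsSchwartz.dunklOp {f : ℝ → ℂ} (hf : IsSchwartz f) (k : ℝ) : IsSchwartz (dunklOp k f) :=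
  hf.deriv.add (hf.oddQuotient.const_mul _)

/-- A chirp is even, so it commutes with the reflection part of $\Lambda_k$. Only the derivative
sees it, and the extra term is exactly $-i\frac db xf$. -/
theorem chirp_mul_lcDunklOp {f : ℝ → ℂ} (hf : IsSchwartz f) (k : ℝ)
    (M : Matrix.SpecialLinearGroup (Fin 2) ℝ) (x : ℝ) :
    chirp (-(M 1 1 / M 0 1)) x * lcDunklOp k M f x =
      dunklOp k (fun y => chirp (-(M 1 1 / M 0 1)) y * f y) x := by
  set a := -(M 1 1 / M 0 1)
  have h1 : oddQuotient (fun y => chirp a y * f y) x = chirp a x * oddQuotient f x := by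
    rcases eq_or_ne x 0 with rfl | hx
    · rw [oddQuotient_zero, oddQuotient_zero,
        ((hasDerivAt_chirp a 0).fun_mul (hf.hasDerivAt 0)).deriv]
      simp
    · rw [oddQuotient_of_ne _ hx, oddQuotient_of_ne _ hx, chirp_apply_neg]
      ring
  rw [lcDunklOp, dunklOp_apply, dunklOp_apply, h1,
    ((hasDerivAt_chirp a x).fun_mul (hf.hasDerivAt x)).deriv,
    show M 1 1 / M 0 1 = -a by simp [a]]
  push_cast
  ring

theorem IsSchwartz.lcDunklOp {f : ℝ → ℂ} (hf : IsSchwartz f) (k : ℝ)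
    (M : Matrix.SpecialLinearGroup (Fin 2) ℝ) : IsSchwartz (lcDunklOp k M f) := by
  convert! (hf.dunklOp k).sub (hf.id_mul.const_mul (Complex.I * ((M 1 1 / M 0 1 : ℝ) : ℂ))) using 2
    with x
  rw [LCDunkl.lcDunklOp]
  ring

theorem IsSchwartz.iterate_lcDunklOp {f : ℝ → ℂ} (hf : IsSchwartz f) (k : ℝ)
    (M : Matrix.SpecialLinearGroup (Fin 2) ℝ) (n : ℕ) :
    IsSchwartz ((LCDunkl.lcDunklOp k M)^[n] f) := by
  induction n with
  | zero => simpa using hf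
  | succ n ih =>
    rw [Function.iterate_succ_apply']
    exact ih.lcDunklOp k M

/-! ### The normalized spherical Bessel functions -/

/-- The coefficient of `x^(2n)` in `j_k(x)`. -/
def besselCoeff (k : ℝ) (n : ℕ) : ℝ :=
  (-1) ^ n * Real.Gamma (k + 1) / (n.factorial * Real.Gamma (n + k + 1) * 4 ^ n)

theorem besselJ_eq_tsum (k x : ℝ) : besselJ k x = ∑' n, besselCoeff k n * x ^ (2 * n) := by
  rw [besselJ, ← tsum_mul_left]
  congr 1 with n
  rw [besselCoeff, div_pow, pow_mul 2 2 n]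
  norm_num
  ring

section

variable {k : ℝ}

theorem besselCoeff_zero (hk : -1 / 2 ≤ k) : besselCoeff k 0 = 1 := by
  have := (Real.Gamma_pos_of_pos (by linarith : 0 < k + 1)).ne'
  simp [besselCoeff, this]

theorem besselCoeff_succ (hk : -1 / 2 ≤ k) (n : ℕ) :
    besselCoeff k (n + 1) = -(besselCoeff k n / (4 * (n + 1) * (n + k + 1))) := by
  have hn : (0 : ℝ) ≤ n := n.cast_nonneg
  have h1 : (n : ℝ) + k + 1 ≠ 0 := by linarith
  have h2 := (Real.Gamma_pos_of_pos (by linarith : 0 < (n : ℝ) + k + 1)).ne'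
  have h3 : Real.Gamma (((n + 1 : ℕ) : ℝ) + k + 1) = (n + k + 1) * Real.Gamma (n + k + 1) := by
    rw [← Real.Gamma_add_one h1]
    push_cast
    ring_nf
  have h4 : (n : ℝ) + 1 ≠ 0 := by linarith
  have h5 : (n.factorial : ℝ) ≠ 0 := by positivity
  rw [besselCoeff, h3, besselCoeff, Nat.factorial_succ]
  push_cast
  field_simp
  ring

theorem besselCoeff_add_one (hk : -1 / 2 ≤ k) (n : ℕ) :
    besselCoeff (k + 1) n = besselCoeff k n * (k + 1) / (n + k + 1) := by
  have hn : (0 : ℝ) ≤ n := n.cast_nonneg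
  have h1 : (n : ℝ) + k + 1 ≠ 0 := by linarith
  have h2 := (Real.Gamma_pos_of_pos (by linarith : 0 < (n : ℝ) + k + 1)).ne'
  have h3 : Real.Gamma ((n : ℝ) + (k + 1) + 1) = (n + k + 1) * Real.Gamma (n + k + 1) := by
    rw [← Real.Gamma_add_one h1]
    ring_nf
  have h5 : (n.factorial : ℝ) ≠ 0 := by positivity
  rw [besselCoeff, h3, besselCoeff, Real.Gamma_add_one (by linarith : k + 1 ≠ 0)]
  field_simp

/-- The ratio of consecutive coefficients is at most $1/(n+1)$ in modulus since $4(n+k+1)\ge1$ for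
$k\ge-\frac12$. Thus the Bessel series is dominated by the exponential series in $x^2$. -/
theorem abs_besselCoeff_le (hk : -1 / 2 ≤ k) (n : ℕ) : |besselCoeff k n| ≤ 1 / n.factorial := by
  induction n with
  | zero => simp [besselCoeff_zero hk]
  | succ n ih =>
    have hn : (0 : ℝ) ≤ n := n.cast_nonneg
    have h5 : (0 : ℝ) < n.factorial := by positivity
    have h1 : 0 < 4 * ((n : ℝ) + 1) * (n + k + 1) := by nlinarith
    rw [besselCoeff_succ hk, abs_neg, abs_div, abs_of_pos h1, Nat.factorial_succ]
    push_cast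
    rw [div_le_div_iff₀ h1 (by positivity)]
    rw [le_div_iff₀ h5] at ih
    have h2 : ((n : ℝ) + 1) * 1 ≤ ((n : ℝ) + 1) * (4 * (n + k + 1)) := by
      gcongr
      linarith
    nlinarith

theorem summable_besselCoeff_mul (hk : -1 / 2 ≤ k) (x : ℝ) :
    Summable fun n => besselCoeff k n * x ^ (2 * n) := by
  refine Summable.of_norm_bounded (Real.summable_pow_div_factorial (x ^ 2)) fun n => ?_
  rw [norm_mul, pow_mul, Real.norm_eq_abs, Real.norm_of_nonneg (by positivity), div_eq_mul_one_div,
    mul_comm]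
  gcongr
  exact abs_besselCoeff_le hk n

theorem hasDerivAt_besselJ (hk : -1 / 2 ≤ k) (x : ℝ) :
    HasDerivAt (besselJ k) (-(x / (2 * (k + 1)) * besselJ (k + 1) x)) x := by
  set r : ℝ := |x| + 1
  have hr : 1 ≤ r := by simp [r]
  have hk1 : k + 1 ≠ 0 := by linarith
  have hx : x ∈ Metric.ball (0 : ℝ) r := by simp [r]
  have hu : Summable fun n : ℕ => 2 * ((2 * r ^ 2) ^ n / n.factorial) :=
    (Real.summable_pow_div_factorial _).mul_left 2
  have hbound : ∀ n : ℕ, ∀ y ∈ Metric.ball (0 : ℝ) r,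
      ‖besselCoeff k n * ((2 * n : ℕ) * y ^ (2 * n - 1))‖ ≤
        2 * ((2 * r ^ 2) ^ n / n.factorial) := by
    intro n y hy
    have hy' : |y| ≤ r := by simpa using (Metric.mem_ball.1 hy).le
    -- The factor $n$ produced by differentiation is absorbed by $n\le2^n$, whence $2r^2$ instead of
    -- $r^2$ in the majorant.
    have h1 : ((2 * n : ℕ) : ℝ) * |y| ^ (2 * n - 1) ≤ 2 * 2 ^ n * r ^ (2 * n) := by
      have h2 : (n : ℝ) ≤ 2 ^ n := by exact_mod_cast Nat.lt_two_pow_self.le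
      have h3 : |y| ^ (2 * n - 1) ≤ r ^ (2 * n) :=
        (pow_le_pow_left₀ (abs_nonneg y) hy' _).trans (pow_le_pow_right₀ hr (by omega))
      push_cast
      gcongr
    rw [norm_mul, norm_mul, norm_pow, Real.norm_eq_abs, Real.norm_eq_abs, Real.norm_eq_abs,
      abs_of_nonneg (by positivity : (0 : ℝ) ≤ ((2 * n : ℕ) : ℝ))]
    calc |besselCoeff k n| * (((2 * n : ℕ) : ℝ) * |y| ^ (2 * n - 1))
        ≤ 1 / n.factorial * (2 * 2 ^ n * r ^ (2 * n)) := by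
          gcongr
          exact abs_besselCoeff_le hk n
      _ = _ := by rw [mul_pow, ← pow_mul]; ring
  have hderiv := hasDerivAt_tsum_of_isPreconnected
    (g := fun n x => besselCoeff k n * x ^ (2 * n))
    (g' := fun n x => besselCoeff k n * ((2 * n : ℕ) * x ^ (2 * n - 1)))
    hu Metric.isOpen_ball (convex_ball (0 : ℝ) r).isPreconnected
    (fun n y _ => (hasDerivAt_pow _ y).const_mul _) hbound hx (summable_besselCoeff_mul hk x) hx
  rw [funext (besselJ_eq_tsum k)]
  convert! hderiv using 1
  rw [besselJ_eq_tsum, ← tsum_mul_left, ← tsum_neg,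
    (Summable.of_norm_bounded hu fun n => hbound n x hx).tsum_eq_zero_add]
  simp only [mul_zero, Nat.cast_zero, zero_mul, zero_add]
  congr 1 with n
  have hn : (0 : ℝ) ≤ n := n.cast_nonneg
  have h3 : (n : ℝ) + k + 1 ≠ 0 := by linarith
  have h5 : (n : ℝ) + 1 ≠ 0 := by linarith
  rw [besselCoeff_add_one hk, besselCoeff_succ hk, show 2 * (n + 1) - 1 = 2 * n + 1 by omega]
  push_cast
  field_simp
  ring

theorem continuous_besselJ (hk : -1 / 2 ≤ k) : Continuous (besselJ k) :=
  continuous_iff_continuousAt.2 fun x => (hasDerivAt_besselJ hk x).continuousAt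

theorem besselJ_neg (k x : ℝ) : besselJ k (-x) = besselJ k x := by
  simp [besselJ_eq_tsum, pow_mul]

theorem besselJ_zero (hk : -1 / 2 ≤ k) : besselJ k 0 = 1 := by
  rw [besselJ_eq_tsum, tsum_eq_single 0 fun n hn => by simp [hn]]
  simp [besselCoeff_zero hk]

/-- This three-term relation, read off from the coefficients, replaces Bessel's differential
equation: it closes the derivative formulas for $j_k$ and $j_{k+1}$. -/
theorem besselJ_recurrence (hk : -1 / 2 ≤ k) (x : ℝ) :
    besselJ k x = besselJ (k + 1) x -
      x ^ 2 / (4 * (k + 1) * (k + 2)) * besselJ (k + 1 + 1) x := by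
  have hk1 : k + 1 ≠ 0 := by linarith
  have hk2 : k + 2 ≠ 0 := by linarith
  have h1 : -1 / 2 ≤ k + 1 := by linarith
  have h2 : -1 / 2 ≤ k + 1 + 1 := by linarith
  rw [besselJ_eq_tsum, besselJ_eq_tsum, besselJ_eq_tsum,
    (summable_besselCoeff_mul hk x).tsum_eq_zero_add,
    (summable_besselCoeff_mul h1 x).tsum_eq_zero_add, besselCoeff_zero hk, besselCoeff_zero h1,
    ← tsum_mul_left, add_sub_assoc,
    ← ((summable_nat_add_iff 1).2 (summable_besselCoeff_mul h1 x)).tsum_sub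
      ((summable_besselCoeff_mul h2 x).mul_left _)]
  congr 2 with n
  have hn : (0 : ℝ) ≤ n := n.cast_nonneg
  have h3 : (n : ℝ) + k + 1 ≠ 0 := by linarith
  have h4 : (n : ℝ) + k + 2 ≠ 0 := by linarith
  have h5 : (n : ℝ) + 1 ≠ 0 := by linarith
  rw [besselCoeff_add_one h1 n, besselCoeff_add_one hk (n + 1), besselCoeff_add_one hk n,
    besselCoeff_succ hk, show (n : ℝ) + (k + 1) + 1 = n + k + 2 by ring,
    show ((n + 1 : ℕ) : ℝ) + k + 1 = n + k + 2 by push_cast; ring,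
    show k + 1 + 1 = k + 2 by ring]
  field_simp
  ring

/-- The left side is the energy $j_k^2+(j_k')^2$, an even function with value $1$ at $0$. Its
derivative is $-(2k+1)xj_{k+1}^2/(2(k+1)^2)$, which is nonpositive on $x\ge0$ precisely because
$k\ge-\frac12$. The energy is also $|E_k(ix,1)|^2$, so this is the bound on the Dunkl kernel. -/
theorem besselJ_sq_add_le_one (hk : -1 / 2 ≤ k) (x : ℝ) :
    besselJ k x ^ 2 + (x / (2 * (k + 1)) * besselJ (k + 1) x) ^ 2 ≤ 1 := by
  have hk1 : k + 1 ≠ 0 := by linarith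
  have hk2 : k + 2 ≠ 0 := by linarith
  set E : ℝ → ℝ := fun x => besselJ k x ^ 2 + (x / (2 * (k + 1)) * besselJ (k + 1) x) ^ 2
  have hE : ∀ x, HasDerivAt E (-(x * besselJ (k + 1) x ^ 2 * (2 * k + 1) / (2 * (k + 1) ^ 2))) x := by
    intro x
    have h1 := hasDerivAt_besselJ hk x
    have h2 := hasDerivAt_besselJ (by linarith : -1 / 2 ≤ k + 1) x
    have h3 := ((hasDerivAt_id x).div_const (2 * (k + 1))).fun_mul h2
    convert! (h1.pow 2).add (h3.pow 2) using 1
    have h4 := besselJ_recurrence hk x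
    simp only [id]
    rw [h4, show k + 1 + 1 = k + 2 by ring]
    simp only [Nat.cast_ofNat, Nat.add_one_sub_one, pow_one]
    field_simp
    ring
  have hanti : AntitoneOn E (Set.Ici 0) := by
    refine antitoneOn_of_deriv_nonpos (convex_Ici 0)
      (fun x _ => (hE x).continuousAt.continuousWithinAt)
      (fun x _ => (hE x).differentiableAt.differentiableWithinAt) fun x hx => ?_
    rw [interior_Ici, Set.mem_Ioi] at hx
    rw [(hE x).deriv, neg_nonpos]
    have : 0 ≤ 2 * k + 1 := by linarith
    positivity
  have h0 : E 0 = 1 := by simp [E, besselJ_zero hk]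
  have habs : E |x| = E x := by
    rcases abs_cases x with ⟨h, _⟩ | ⟨h, _⟩
    · rw [h]
    · simp only [h, E, besselJ_neg, neg_div, neg_mul, neg_sq]
  calc E x = E |x| := habs.symm
    _ ≤ E 0 := hanti Set.self_mem_Ici (abs_nonneg x) (abs_nonneg x)
    _ = 1 := h0

theorem abs_besselJ_le_one (hk : -1 / 2 ≤ k) (x : ℝ) : |besselJ k x| ≤ 1 := by
  rw [← sq_le_one_iff_abs_le_one]
  have := besselJ_sq_add_le_one hk x
  nlinarith [sq_nonneg (x / (2 * (k + 1)) * besselJ (k + 1) x)]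

theorem abs_deriv_besselJ_le_one (hk : -1 / 2 ≤ k) (x : ℝ) :
    |x / (2 * (k + 1)) * besselJ (k + 1) x| ≤ 1 := by
  rw [← sq_le_one_iff_abs_le_one]
  have := besselJ_sq_add_le_one hk x
  nlinarith [sq_nonneg (besselJ k x)]

/-! ### The Dunkl kernel -/

/-- The function `t ↦ E_k(i t, 1)`. -/
def dunklExp (k t : ℝ) : ℂ :=
  besselJ k t + Complex.I * (((t / (2 * (k + 1)) * besselJ (k + 1) t : ℝ)) : ℂ)

/-- The function `t ↦ (E_k(i t, 1) - E_k(-i t, 1)) / 2t`. -/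
def dunklExpQuot (k t : ℝ) : ℂ := Complex.I / (2 * (k + 1)) * besselJ (k + 1) t

theorem dunklKernel_eq (k l x : ℝ) : dunklKernel k l x = dunklExp k (l * x) := by
  rw [dunklKernel, dunklExp]
  push_cast
  ring

theorem dunklExp_zero (hk : -1 / 2 ≤ k) : dunklExp k 0 = 1 := by
  simp [dunklExp, besselJ_zero hk]

theorem norm_dunklExp_le_one (hk : -1 / 2 ≤ k) (t : ℝ) : ‖dunklExp k t‖ ≤ 1 := by
  rw [← sq_le_one_iff₀ (norm_nonneg _), ← Complex.normSq_eq_norm_sq, dunklExp, mul_comm Complex.I,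
    Complex.normSq_add_mul_I]
  exact besselJ_sq_add_le_one hk t

theorem conj_dunklExp (k t : ℝ) : conj (dunklExp k t) = dunklExp k (-t) := by
  simp only [dunklExp, map_add, map_mul, Complex.conj_ofReal, Complex.conj_I, besselJ_neg]
  push_cast
  ring

theorem dunklExp_sub_neg (k t : ℝ) :
    dunklExp k t - dunklExp k (-t) = 2 * t * dunklExpQuot k t := by
  simp only [dunklExp, dunklExpQuot, besselJ_neg]
  push_cast
  ring

/-- This is the eigenvalue equation $\Lambda_kE=iE$ for $E(t)=E_k(it,1)$, with the difference part
moved to the right. -/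
theorem hasDerivAt_dunklExp (hk : -1 / 2 ≤ k) (t : ℝ) :
    HasDerivAt (dunklExp k) (Complex.I * dunklExp k t - (2 * k + 1) * dunklExpQuot k t) t := by
  have hk1 : (k : ℂ) + 1 ≠ 0 := by exact_mod_cast (by linarith : k + 1 ≠ 0)
  have hk2 : (k : ℂ) + 2 ≠ 0 := by exact_mod_cast (by linarith : k + 2 ≠ 0)
  have h1 := hasDerivAt_besselJ hk t
  have h2 := hasDerivAt_besselJ (by linarith : -1 / 2 ≤ k + 1) t
  have h3 := ((hasDerivAt_id t).div_const (2 * (k + 1))).fun_mul h2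
  convert! h1.ofReal_comp.add (h3.ofReal_comp.const_mul Complex.I) using 1
  have h4 := besselJ_recurrence hk t
  rw [dunklExp, dunklExpQuot, h4, show k + 1 + 1 = k + 2 by ring]
  simp only [id]
  push_cast
  field_simp
  ring_nf
  simp only [Complex.I_sq]
  ring

theorem continuous_dunklExp (hk : -1 / 2 ≤ k) : Continuous (dunklExp k) :=
  continuous_iff_continuousAt.2 fun x => (hasDerivAt_dunklExp hk x).continuousAt

theorem continuous_dunklExpQuot (hk : -1 / 2 ≤ k) : Continuous (dunklExpQuot k) :=
  (Complex.continuous_ofReal.comp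
    (continuous_besselJ (by linarith : -1 / 2 ≤ k + 1))).const_mul _

theorem norm_dunklExpQuot_le_one (hk : -1 / 2 ≤ k) (t : ℝ) : ‖dunklExpQuot k t‖ ≤ 1 := by
  have h1 : (2 * (k + 1) : ℂ) = ((2 * (k + 1) : ℝ) : ℂ) := by push_cast; ring
  rw [dunklExpQuot, norm_mul, norm_div, h1, Complex.norm_real, Complex.norm_real, Complex.norm_I,
    Real.norm_of_nonneg (by linarith), Real.norm_eq_abs]
  have h2 : 1 / (2 * (k + 1)) ≤ 1 := by
    rw [div_le_one (by linarith)]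
    linarith
  exact mul_le_one₀ h2 (abs_nonneg _) (abs_besselJ_le_one (by linarith) t)

end

/-! ### Integration against the Dunkl measure -/

/-- The density of `μ_k`. -/
def dunklWeight (k x : ℝ) : ℝ := |x| ^ (2 * k + 1) / (2 ^ (k + 1) * Real.Gamma (k + 1))

theorem dunklMeasure_eq_withDensity (k : ℝ) :
    dunklMeasure k = volume.withDensity fun x => ENNReal.ofReal (dunklWeight k x) := rfl

theorem measurable_dunklWeight (k : ℝ) : Measurable (dunklWeight k) := by
  unfold dunklWeight
  fun_prop

theorem dunklWeight_neg (k x : ℝ) : dunklWeight k (-x) = dunklWeight k x := by simp [dunklWeight]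

section

variable {k : ℝ}

theorem dunklWeight_const_pos (hk : -1 / 2 ≤ k) : 0 < 2 ^ (k + 1) * Real.Gamma (k + 1) :=
  mul_pos (Real.rpow_pos_of_pos (by norm_num) _) (Real.Gamma_pos_of_pos (by linarith))

theorem dunklWeight_nonneg (hk : -1 / 2 ≤ k) (x : ℝ) : 0 ≤ dunklWeight k x :=
  div_nonneg (by positivity) (dunklWeight_const_pos hk).le

theorem continuous_dunklWeight (hk : -1 / 2 ≤ k) : Continuous (dunklWeight k) :=
  (continuous_abs.rpow_const fun _ => Or.inr (by linarith)).div_const _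

theorem integral_dunklMeasure (hk : -1 / 2 ≤ k) (g : ℝ → ℂ) :
    ∫ x, g x ∂(dunklMeasure k) = ∫ x, (dunklWeight k x : ℂ) * g x := by
  rw [dunklMeasure_eq_withDensity, integral_withDensity_eq_integral_toReal_smul
    (measurable_dunklWeight k).ennreal_ofReal (by simp)]
  refine integral_congr_ae (Filter.Eventually.of_forall fun x => ?_)
  simp only
  rw [ENNReal.toReal_ofReal (dunklWeight_nonneg hk x), Complex.real_smul]

theorem integrable_dunklMeasure_iff (hk : -1 / 2 ≤ k) (g : ℝ → ℂ) :
    Integrable g (dunklMeasure k) ↔ Integrable fun x => (dunklWeight k x : ℂ) * g x := by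
  rw [dunklMeasure_eq_withDensity, integrable_withDensity_iff_integrable_smul'
    (measurable_dunklWeight k).ennreal_ofReal (by simp)]
  refine integrable_congr (Filter.Eventually.of_forall fun x => ?_)
  simp only
  rw [ENNReal.toReal_ofReal (dunklWeight_nonneg hk x), Complex.real_smul]

theorem integral_comp_neg_dunklMeasure (hk : -1 / 2 ≤ k) (g : ℝ → ℂ) :
    ∫ x, g (-x) ∂(dunklMeasure k) = ∫ x, g x ∂(dunklMeasure k) := by
  rw [integral_dunklMeasure hk, integral_dunklMeasure hk,
    ← integral_neg_eq_self fun x => (dunklWeight k x : ℂ) * g x]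
  simp only [dunklWeight_neg]

theorem integral_comp_mul_dunklMeasure (hk : -1 / 2 ≤ k) (g : ℝ → ℂ) {c : ℝ} (hc : c ≠ 0) :
    ∫ x, g (c * x) ∂(dunklMeasure k) =
      ((|c| ^ (2 * (k + 1)))⁻¹ : ℝ) * ∫ x, g x ∂(dunklMeasure k) := by
  have hc' : 0 < |c| := abs_pos.2 hc
  rw [integral_dunklMeasure hk, integral_dunklMeasure hk]
  have h := Measure.integral_comp_mul_left (fun x => (dunklWeight k x : ℂ) * g x) c
  have h1 : ∀ x, dunklWeight k (c * x) = |c| ^ (2 * k + 1) * dunklWeight k x := fun x => by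
    rw [dunklWeight, dunklWeight, abs_mul, Real.mul_rpow (abs_nonneg _) (abs_nonneg _), mul_div_assoc]
  simp only [h1, Complex.ofReal_mul, mul_assoc] at h
  rw [integral_const_mul, Complex.real_smul] at h
  have h2 : |c| ^ (2 * (k + 1)) = |c| ^ (2 * k + 1) * |c| := by
    rw [← Real.rpow_add_one hc'.ne']
    ring_nf
  have h3 : ((|c| ^ (2 * k + 1) : ℝ) : ℂ) ≠ 0 := by
    exact_mod_cast (Real.rpow_pos_of_pos hc' _).ne'
  rw [h2, mul_inv, Complex.ofReal_mul, mul_assoc, ← abs_inv, ← h, Complex.ofReal_inv,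
    inv_mul_cancel_left₀ h3]

/-- A factor $x^2$ raises the order of the measure by one; this is what makes derivatives of Hankel
transforms Hankel transforms again. -/
theorem integral_dunklMeasure_succ (hk : -1 / 2 ≤ k) (g : ℝ → ℂ) :
    2 * (k + 1) * ∫ x, g x ∂(dunklMeasure (k + 1)) = ∫ x, (x : ℂ) ^ 2 * g x ∂(dunklMeasure k) := by
  rw [integral_dunklMeasure hk, integral_dunklMeasure (by linarith), ← integral_const_mul]
  congr 1 with x
  have h1 : 2 * (k + 1) * dunklWeight (k + 1) x = dunklWeight k x * x ^ 2 := by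
    have h2 : |x| ^ (2 * (k + 1) + 1) = |x| ^ (2 * k + 1) * x ^ 2 := by
      rw [← sq_abs x, ← Real.rpow_natCast |x| 2, ← Real.rpow_add_of_nonneg (abs_nonneg x)
        (by linarith) (by norm_num)]
      norm_num
      ring_nf
    have h3 := (Real.Gamma_pos_of_pos (by linarith : 0 < k + 1)).ne'
    have h4 : k + 1 ≠ 0 := by linarith
    have h5 : (2 : ℝ) ^ (k + 1) ≠ 0 := (Real.rpow_pos_of_pos (by norm_num) _).ne'
    rw [dunklWeight, dunklWeight, h2, Real.Gamma_add_one h4, Real.rpow_add_one (by norm_num : (2 : ℝ) ≠ 0) (k + 1)]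
    field_simp
  have h6 := congrArg (fun r : ℝ => (r : ℂ)) h1
  push_cast at h6
  rw [← mul_assoc, h6, mul_assoc]

/-- Folding onto the half-line replaces $|x|^{2k+1}$, which may fail to be differentiable at $0$, by
the power $x^{2k+1}$ on $x>0$, and pairs each $x$ with its reflection. -/
theorem integral_dunklMeasure_eq_Ioi (hk : -1 / 2 ≤ k) {g : ℝ → ℂ}
    (hg : Integrable g (dunklMeasure k)) :
    ∫ x, g x ∂(dunklMeasure k) =
      ∫ x in Set.Ioi (0 : ℝ), (dunklWeight k x : ℂ) * (g x + g (-x)) := by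
  have h1 := (integrable_dunklMeasure_iff hk g).1 hg
  have h2 : ∫ x in Set.Iic (0 : ℝ), (dunklWeight k x : ℂ) * g x =
      ∫ x in Set.Ioi (0 : ℝ), (dunklWeight k x : ℂ) * g (-x) := by
    have := integral_comp_neg_Ioi (0 : ℝ) fun x => (dunklWeight k x : ℂ) * g x
    simpa only [dunklWeight_neg, neg_zero] using this.symm
  have h3 : Integrable fun x => (dunklWeight k x : ℂ) * g (-x) := by
    simpa only [dunklWeight_neg] using h1.comp_neg
  rw [integral_dunklMeasure hk, ← intervalIntegral.integral_Iic_add_Ioi h1.integrableOn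
    h1.integrableOn, h2, ← integral_add h3.integrableOn h1.integrableOn]
  congr 1 with x
  ring

theorem IsSchwartz.integrable {f : ℝ → ℂ} (hf : IsSchwartz f) (hk : -1 / 2 ≤ k) :
    Integrable f (dunklMeasure k) := by
  obtain ⟨φ, rfl⟩ := hf
  have := dunklMeasure_hasTemperateGrowth hk
  exact φ.integrable

theorem IsSchwartz.integrable_mul {f h : ℝ → ℂ} (hf : IsSchwartz f) (hk : -1 / 2 ≤ k)
    (hh : Continuous h) {C : ℝ} (hC : ∀ x, ‖h x‖ ≤ C) :
    Integrable (fun x => f x * h x) (dunklMeasure k) :=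
  (hf.integrable hk).mul_bdd hh.aestronglyMeasurable (Filter.Eventually.of_forall hC)

/-! ### Skew-symmetry of the Dunkl operator -/

theorem tendsto_rpow_mul_norm {f : ℝ → ℂ} (hf : IsSchwartz f) (s : ℝ) :
    Filter.Tendsto (fun x : ℝ => x ^ s * ‖f x‖) Filter.atTop (nhds 0) := by
  obtain ⟨φ, rfl⟩ := hf
  have h1 : (fun x : ℝ => φ x) =O[Filter.atTop] fun x : ℝ => ‖x‖ ^ (-s - 1) :=
    (φ.isBigO_cocompact_rpow (-s - 1)).mono atTop_le_cocompact
  have h2 : (fun x : ℝ => x ^ s * ‖φ x‖) =O[Filter.atTop] fun x : ℝ => x ^ s * ‖x‖ ^ (-s - 1) :=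
    (Asymptotics.isBigO_refl _ _).mul h1.norm_left
  refine h2.trans_tendsto ?_
  refine (tendsto_inv_atTop_zero (𝕜 := ℝ)).congr' ?_
  filter_upwards [Filter.eventually_gt_atTop 0] with x hx
  rw [Real.norm_of_nonneg hx.le, ← Real.rpow_add hx, show s + (-s - 1) = -1 by ring,
    Real.rpow_neg_one]

/-- Integration by parts for the Dunkl operator; `q` is the function `(h(x) - h(-x)) / 2x`. -/
theorem integral_dunklOp_mul (hk : -1 / 2 ≤ k) {f h h' q : ℝ → ℂ} (hf : IsSchwartz f)
    (hh : ∀ x, HasDerivAt h (h' x) x) (hq : ∀ x : ℝ, 2 * x * q x = h x - h (-x))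
    (hh' : Continuous h') (hqc : Continuous q) {A B C : ℝ} (hA : ∀ x, ‖h x‖ ≤ A)
    (hB : ∀ x, ‖h' x‖ ≤ B) (hC : ∀ x, ‖q x‖ ≤ C) :
    ∫ x, dunklOp k f x * h x ∂(dunklMeasure k) =
      -∫ x, f x * (h' x + (2 * k + 1) * q x) ∂(dunklMeasure k) := by
  have hhc : Continuous h := continuous_iff_continuousAt.2 fun x => (hh x).continuousAt
  have hi1 := (hf.dunklOp k).integrable_mul hk hhc hA
  have hi2 : Integrable (fun x => f x * (h' x + (2 * k + 1) * q x)) (dunklMeasure k) := by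
    refine hf.integrable_mul hk (by fun_prop) (C := B + ‖(2 * k + 1 : ℂ)‖ * C) fun x => ?_
    refine (norm_add_le _ _).trans ?_
    rw [norm_mul]
    gcongr
    exacts [hB x, hC x]
  have hi := hi1.add hi2
  rw [← add_eq_zero_iff_eq_neg, ← integral_add hi1 hi2]
  change ∫ x, ((fun x => dunklOp k f x * h x) + fun x => f x * (h' x + (2 * k + 1) * q x)) x
    ∂(dunklMeasure k) = 0
  rw [integral_dunklMeasure_eq_Ioi hk hi]
  set K : ℝ := 2 ^ (k + 1) * Real.Gamma (k + 1)
  have hK : (K : ℂ) ≠ 0 := by exact_mod_cast (dunklWeight_const_pos hk).ne'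
  -- Twice the odd part of $fh$. The folded integrand turns out to be, up to the constant $K$, the
  -- derivative of $x^{2k+1}v$.
  set v : ℝ → ℂ := fun x => f x * h x - f (-x) * h (-x)
  set v' : ℝ → ℂ := fun x => deriv f x * h x + f x * h' x + (deriv f (-x) * h (-x) + f (-x) * h' (-x))
  have hv : ∀ x, HasDerivAt v (v' x) x := by
    intro x
    have h1 : ∀ x, HasDerivAt (fun x => f x * h x) (deriv f x * h x + f x * h' x) x :=
      fun x => (hf.hasDerivAt x).fun_mul (hh x)
    convert! (h1 x).sub ((h1 (-x)).scomp x (hasDerivAt_neg x)) using 1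
    simp only [v', neg_smul, one_smul, sub_neg_eq_add]
  have hsum : ∀ x : ℝ, (x : ℂ) * (((fun x => dunklOp k f x * h x) +
      fun x => f x * (h' x + (2 * k + 1) * q x)) x + ((fun x => dunklOp k f x * h x) +
      fun x => f x * (h' x + (2 * k + 1) * q x)) (-x)) = x * v' x + (2 * k + 1) * v x := by
    intro x
    have h1 := two_mul_oddQuotient f x
    have h2 := hq x
    have h3 := hq (-x)
    simp only [Pi.add_apply, dunklOp_apply, oddQuotient_neg, v', v]
    push_cast at h3
    rw [neg_neg] at h3
    linear_combination (2 * k + 1) / 2 * (h x + h (-x)) * h1 + (2 * k + 1) / 2 * f x * h2 -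
      (2 * k + 1) / 2 * f (-x) * h3
  have hwc : Continuous fun x : ℝ => ((x ^ (2 * k + 1) : ℝ) : ℂ) :=
    Complex.continuous_ofReal.comp (continuous_id.rpow_const fun _ => Or.inr (by linarith))
  have hvc : Continuous v := continuous_iff_continuousAt.2 fun x => (hv x).continuousAt
  have key := integral_Ioi_of_hasDerivAt_of_tendsto (a := 0) (m := 0)
    (f := fun x : ℝ => (K : ℂ)⁻¹ * (((x ^ (2 * k + 1) : ℝ) : ℂ) * v x))
    (f' := fun x => (dunklWeight k x : ℂ) * (((fun x => dunklOp k f x * h x) +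
      fun x => f x * (h' x + (2 * k + 1) * q x)) x + ((fun x => dunklOp k f x * h x) +
      fun x => f x * (h' x + (2 * k + 1) * q x)) (-x)))
    (((hwc.mul hvc).const_mul _).continuousWithinAt) ?_ ?_ ?_
  · rw [key]
    -- The boundary term at $0$ vanishes because $v(0)=0$; this matters when $k=-\frac12$, where the
    -- power $0^{2k+1}$ is $1$.
    simp [v]
  · intro x hx
    have hx0 : (0 : ℝ) < x := hx
    have hx' : (x : ℂ) ≠ 0 := by exact_mod_cast hx0.ne'
    have h1 := (Real.hasDerivAt_rpow_const (p := 2 * k + 1) (Or.inl hx0.ne')).ofReal_comp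
    convert! (h1.fun_mul (hv x)).const_mul (K : ℂ)⁻¹ using 1
    have h2 := hsum x
    rw [(eq_div_iff hx').2 ((mul_comm _ _).trans h2), dunklWeight, abs_of_pos hx0, Real.rpow_sub_one hx0.ne']
    change (((x ^ (2 * k + 1) / K : ℝ)) : ℂ) * _ = _
    push_cast
    field_simp
    ring
  · have h1 := (integrable_dunklMeasure_iff hk _).1 hi
    have h2 := h1.add h1.comp_neg
    refine h2.integrableOn.congr_fun (fun x _ => ?_) measurableSet_Ioi
    simp only [Pi.add_apply, dunklWeight_neg]
    ring
  · have h1 := ((tendsto_rpow_mul_norm hf (2 * k + 1)).add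
      (tendsto_rpow_mul_norm hf.comp_neg (2 * k + 1))).const_mul (‖(K : ℂ)⁻¹‖ * A)
    rw [add_zero, mul_zero] at h1
    refine squeeze_zero_norm' ?_ h1
    filter_upwards [Filter.eventually_gt_atTop 0] with x hx
    rw [norm_mul, norm_mul, Complex.norm_real, Real.norm_of_nonneg (by positivity)]
    have h2 : ‖v x‖ ≤ A * (‖f x‖ + ‖f (-x)‖) := by
      refine (norm_sub_le _ _).trans ?_
      rw [norm_mul, norm_mul]
      nlinarith [hA x, hA (-x), norm_nonneg (f x), norm_nonneg (f (-x))]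
    calc ‖(K : ℂ)⁻¹‖ * (x ^ (2 * k + 1) * ‖v x‖)
        ≤ ‖(K : ℂ)⁻¹‖ * (x ^ (2 * k + 1) * (A * (‖f x‖ + ‖f (-x)‖))) := by gcongr
      _ = _ := by ring

end

/-! ### The Dunkl transform -/

/-- The Dunkl transform `F_k f(y) = ∫ f(x) E_k(-i y, x) dμ_k(x)`. -/
def dunklTransform (k : ℝ) (f : ℝ → ℂ) (y : ℝ) : ℂ :=
  ∫ x, f x * dunklExp k (-(x * y)) ∂(dunklMeasure k)

section

variable {k : ℝ} {f g : ℝ → ℂ}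

theorem continuous_dunklExp_mul (hk : -1 / 2 ≤ k) (y : ℝ) :
    Continuous fun x : ℝ => dunklExp k (-(x * y)) :=
  (continuous_dunklExp hk).comp (by fun_prop)

theorem continuous_dunklExpQuot_mul (hk : -1 / 2 ≤ k) (y : ℝ) :
    Continuous fun x : ℝ => dunklExpQuot k (-(x * y)) :=
  (continuous_dunklExpQuot hk).comp (by fun_prop)

theorem integrable_mul_dunklExp (hk : -1 / 2 ≤ k) (hf : IsSchwartz f) (y : ℝ) :
    Integrable (fun x => f x * dunklExp k (-(x * y))) (dunklMeasure k) :=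
  hf.integrable_mul hk (continuous_dunklExp_mul hk y) fun _ => norm_dunklExp_le_one hk _

theorem integrable_mul_dunklExpQuot (hk : -1 / 2 ≤ k) (hf : IsSchwartz f) (y : ℝ) :
    Integrable (fun x => f x * dunklExpQuot k (-(x * y))) (dunklMeasure k) :=
  hf.integrable_mul hk (continuous_dunklExpQuot_mul hk y) fun _ => norm_dunklExpQuot_le_one hk _

theorem dunklTransform_add (hk : -1 / 2 ≤ k) (hf : IsSchwartz f) (hg : IsSchwartz g) (y : ℝ) :
    dunklTransform k (fun x => f x + g x) y = dunklTransform k f y + dunklTransform k g y := by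
  rw [dunklTransform, dunklTransform, dunklTransform,
    ← integral_add (integrable_mul_dunklExp hk hf y) (integrable_mul_dunklExp hk hg y)]
  simp only [add_mul]

theorem dunklTransform_const_mul (k : ℝ) (c : ℂ) (f : ℝ → ℂ) (y : ℝ) :
    dunklTransform k (fun x => c * f x) y = c * dunklTransform k f y := by
  rw [dunklTransform, dunklTransform, ← integral_const_mul]
  simp only [mul_assoc]

theorem dunklTransform_comp_neg (hk : -1 / 2 ≤ k) (f : ℝ → ℂ) (y : ℝ) :
    dunklTransform k (fun x => f (-x)) y = dunklTransform k f (-y) := by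
  rw [dunklTransform, dunklTransform, ← integral_comp_neg_dunklMeasure hk]
  simp only [neg_neg, neg_mul, mul_neg]

theorem conj_dunklTransform (k : ℝ) (f : ℝ → ℂ) (y : ℝ) :
    conj (dunklTransform k f y) = dunklTransform k (fun x => conj (f x)) (-y) := by
  rw [dunklTransform, dunklTransform, ← integral_conj]
  simp only [map_mul, conj_dunklExp, mul_neg]

theorem norm_dunklTransform_le (hk : -1 / 2 ≤ k) (hf : IsSchwartz f) (y : ℝ) :
    ‖dunklTransform k f y‖ ≤ ∫ x, ‖f x‖ ∂(dunklMeasure k) := by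
  refine norm_integral_le_of_norm_le (hf.integrable hk).norm (Filter.Eventually.of_forall fun x => ?_)
  rw [norm_mul]
  exact mul_le_of_le_one_right (norm_nonneg _) (norm_dunklExp_le_one hk _)

theorem hasDerivAt_dunklTransform (hk : -1 / 2 ≤ k) (hf : IsSchwartz f) (y : ℝ) :
    HasDerivAt (dunklTransform k f)
      (∫ x : ℝ, -(x * f x) * (Complex.I * dunklExp k (-(x * y)) -
        (2 * k + 1) * dunklExpQuot k (-(x * y))) ∂(dunklMeasure k)) y := by
  refine (hasDerivAt_integral_of_dominated_loc_of_deriv_le (𝕜 := ℝ) (s := Set.univ)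
    (F := fun y (x : ℝ) => f x * dunklExp k (-(x * y)))
    (F' := fun y (x : ℝ) => -(x * f x) * (Complex.I * dunklExp k (-(x * y)) -
        (2 * k + 1) * dunklExpQuot k (-(x * y))))
    (bound := fun x : ℝ => ‖(x : ℂ) * f x‖ * (1 + ‖(2 * k + 1 : ℂ)‖)) Filter.univ_mem ?_ ?_ ?_ ?_ ?_ ?_).2
  · exact Filter.Eventually.of_forall fun y =>
      (hf.continuous.mul (continuous_dunklExp_mul hk y)).aestronglyMeasurable
  · exact integrable_mul_dunklExp hk hf y
  · exact (hf.id_mul.continuous.neg.mul (((continuous_dunklExp_mul hk y).const_mul _).sub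
      ((continuous_dunklExpQuot_mul hk y).const_mul _))).aestronglyMeasurable
  · refine Filter.Eventually.of_forall fun x y _ => ?_
    rw [norm_mul, norm_neg]
    gcongr
    refine (norm_sub_le _ _).trans ?_
    rw [norm_mul, norm_mul, Complex.norm_I, one_mul]
    gcongr
    · exact norm_dunklExp_le_one hk _
    · exact mul_le_of_le_one_right (norm_nonneg _) (norm_dunklExpQuot_le_one hk _)
  · exact (hf.id_mul.integrable hk).norm.mul_const _
  · refine Filter.Eventually.of_forall fun x y _ => ?_
    have h1 : HasDerivAt (fun y : ℝ => -(x * y)) (-x) y := by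
      simpa using ((hasDerivAt_id y).const_mul x).fun_neg
    convert! ((hasDerivAt_dunklExp hk (-(x * y))).scomp y h1).const_mul (f x) using 1
    simp only [Complex.real_smul]
    push_cast
    ring

/-- For $y\neq0$ the quotient passes inside the integral. At $y=0$ it is the derivative, and the
integrands agree because $i-(2k+1)\frac{i}{2(k+1)}=\frac{i}{2(k+1)}$. -/
theorem oddQuotient_dunklTransform (hk : -1 / 2 ≤ k) (hf : IsSchwartz f) (y : ℝ) :
    oddQuotient (dunklTransform k f) y =
      ∫ x : ℝ, -(x * f x) * dunklExpQuot k (-(x * y)) ∂(dunklMeasure k) := by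
  rcases eq_or_ne y 0 with rfl | hy
  · have hk1 : (k : ℂ) + 1 ≠ 0 := by exact_mod_cast (by linarith : k + 1 ≠ 0)
    rw [oddQuotient_zero, (hasDerivAt_dunklTransform hk hf 0).deriv]
    congr 1 with x
    simp only [mul_zero, neg_zero, dunklExp_zero hk, dunklExpQuot,
      besselJ_zero (by linarith : -1 / 2 ≤ k + 1)]
    field_simp
    push_cast
    ring
  · have hy' : (y : ℂ) ≠ 0 := by exact_mod_cast hy
    rw [oddQuotient_of_ne _ hy, div_eq_iff (by simpa using hy'), dunklTransform, dunklTransform,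
      ← integral_sub (integrable_mul_dunklExp hk hf y) (integrable_mul_dunklExp hk hf (-y)),
      ← integral_mul_const]
    congr 1 with x
    have h := dunklExp_sub_neg k (-(x * y))
    rw [mul_neg]
    push_cast at h
    linear_combination f x * h

/-- The difference part of $\Lambda_k$ cancels the correction term in the derivative of the kernel,
as the eigenvalue equation demands. -/
theorem dunklOp_dunklTransform (hk : -1 / 2 ≤ k) (hf : IsSchwartz f) (y : ℝ) :
    dunklOp k (dunklTransform k f) y =
      -Complex.I * dunklTransform k (fun x : ℝ => (x : ℂ) * f x) y := by
  rw [dunklOp_apply, (hasDerivAt_dunklTransform hk hf y).deriv, oddQuotient_dunklTransform hk hf,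
    dunklTransform, ← integral_const_mul, ← integral_const_mul, ← integral_add]
  · congr 1 with x
    ring
  · refine (((integrable_mul_dunklExp hk hf.id_mul y).const_mul (-Complex.I)).add
      ((integrable_mul_dunklExpQuot hk hf.id_mul y).const_mul (2 * k + 1))).congr
      (Filter.Eventually.of_forall fun x => ?_)
    simp only [Pi.add_apply]
    ring
  · refine ((integrable_mul_dunklExpQuot hk hf.id_mul y).const_mul (-(2 * k + 1))).congr
      (Filter.Eventually.of_forall fun x => ?_)
    simp only
    ring

/-- Integration by parts moves $\Lambda_k$ onto the kernel, an eigenfunction with eigenvalue $-iy$.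
-/
theorem dunklTransform_dunklOp (hk : -1 / 2 ≤ k) (hf : IsSchwartz f) (y : ℝ) :
    dunklTransform k (dunklOp k f) y = Complex.I * y * dunklTransform k f y := by
  have hh : ∀ x : ℝ, HasDerivAt (fun x : ℝ => dunklExp k (-(x * y)))
      (-y * (Complex.I * dunklExp k (-(x * y)) - (2 * k + 1) * dunklExpQuot k (-(x * y)))) x := by
    intro x
    have h1 : HasDerivAt (fun x : ℝ => -(x * y)) (-y) x := by
      simpa using ((hasDerivAt_id x).mul_const y).fun_neg
    convert! (hasDerivAt_dunklExp hk (-(x * y))).scomp x h1 using 1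
    rw [Complex.real_smul]
    push_cast
    ring
  rw [dunklTransform, integral_dunklOp_mul hk hf hh
    (q := fun x => -y * dunklExpQuot k (-(x * y))) (fun x => ?_)
    (continuous_const.mul (((continuous_dunklExp_mul hk y).const_mul _).sub
      ((continuous_dunklExpQuot_mul hk y).const_mul _)))
    (continuous_const.mul (continuous_dunklExpQuot_mul hk y)) (A := 1)
    (B := ‖(-y : ℂ)‖ * (1 + ‖(2 * k + 1 : ℂ)‖)) (C := ‖(-y : ℂ)‖)
    (fun x => norm_dunklExp_le_one hk _) (fun x => ?_) (fun x => ?_), dunklTransform,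
    ← integral_const_mul, ← integral_neg]
  · congr 1 with x
    ring
  · have h := dunklExp_sub_neg k (-(x * y))
    rw [neg_mul x y, h]
    push_cast
    ring
  · rw [norm_mul]
    gcongr
    refine (norm_sub_le _ _).trans ?_
    rw [norm_mul, norm_mul, Complex.norm_I, one_mul]
    gcongr
    · exact norm_dunklExp_le_one hk _
    · exact mul_le_of_le_one_right (norm_nonneg _) (norm_dunklExpQuot_le_one hk _)
  · rw [norm_mul]
    exact mul_le_of_le_one_right (norm_nonneg _) (norm_dunklExpQuot_le_one hk _)

/-- Up to a power of $i$, $y^n$ times the transform of $f$ is the transform of $\Lambda_k^nf$, which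
is bounded by an $L^1$ norm. -/
theorem exists_norm_pow_mul_dunklTransform_le (hk : -1 / 2 ≤ k) (n : ℕ) :
    ∀ {f : ℝ → ℂ}, IsSchwartz f →
      ∃ C : ℝ, ∀ y : ℝ, ‖(y : ℂ) ^ n * dunklTransform k f y‖ ≤ C := by
  induction n with
  | zero => exact fun {f} hf => ⟨_, fun y => by simpa using norm_dunklTransform_le hk hf y⟩
  | succ n ih =>
    intro f hf
    obtain ⟨C, hC⟩ := ih (hf.dunklOp k)
    refine ⟨C, fun y => ?_⟩
    have := hC y
    rw [dunklTransform_dunklOp hk hf] at this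
    convert! this using 1
    simp only [norm_mul, Complex.norm_I, norm_pow]
    ring

/-! ### The Dunkl transform preserves Schwartz functions -/

/-- The transform with kernel `j_k(x y)`. -/
def hankelTransform (k : ℝ) (f : ℝ → ℂ) (y : ℝ) : ℂ :=
  ∫ x, f x * besselJ k (x * y) ∂(dunklMeasure k)

theorem continuous_besselJ_mul (hk : -1 / 2 ≤ k) (y : ℝ) :
    Continuous fun x : ℝ => (besselJ k (x * y) : ℂ) :=
  Complex.continuous_ofReal.comp ((continuous_besselJ hk).comp (by fun_prop))

theorem norm_besselJ_le_one (hk : -1 / 2 ≤ k) (t : ℝ) : ‖(besselJ k t : ℂ)‖ ≤ 1 := by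
  rw [Complex.norm_real]
  exact abs_besselJ_le_one hk t

theorem integrable_mul_besselJ (hk : -1 / 2 ≤ k) (hf : IsSchwartz f) (y : ℝ) :
    Integrable (fun x => f x * besselJ k (x * y)) (dunklMeasure k) :=
  hf.integrable_mul hk (continuous_besselJ_mul hk y) fun _ => norm_besselJ_le_one hk _

theorem hankelTransform_eq (hk : -1 / 2 ≤ k) (hf : IsSchwartz f) (y : ℝ) :
    hankelTransform k f y = 1 / 2 * (dunklTransform k f y + dunklTransform k f (-y)) := by
  rw [hankelTransform, dunklTransform, dunklTransform,
    ← integral_add (integrable_mul_dunklExp hk hf y) (integrable_mul_dunklExp hk hf (-y)),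
    ← integral_const_mul]
  congr 1 with x
  simp only [dunklExp, mul_neg, neg_neg, besselJ_neg]
  push_cast
  ring

theorem exists_norm_pow_mul_hankelTransform_le (hk : -1 / 2 ≤ k) (n : ℕ) (hf : IsSchwartz f) :
    ∃ C : ℝ, ∀ y : ℝ, ‖(y : ℂ) ^ n * hankelTransform k f y‖ ≤ C := by
  obtain ⟨C, hC⟩ := exists_norm_pow_mul_dunklTransform_le hk n hf
  refine ⟨1 / 2 * (C + C), fun y => ?_⟩
  have h1 := hC y
  have h2 := hC (-y)
  rw [hankelTransform_eq hk hf, mul_left_comm, mul_add, norm_mul]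
  push_cast at h2
  rw [norm_mul, norm_pow, norm_neg, ← norm_pow, ← norm_mul] at h2
  have h3 := norm_add_le ((y : ℂ) ^ n * dunklTransform k f y) ((y : ℂ) ^ n * dunklTransform k f (-y))
  norm_num
  linarith

/-- Differentiating $j_k(xy)$ in $y$ yields a factor $x^2y$; the $x^2$ is absorbed into $\mu_{k+1}$.
The function $f$ is unchanged and only the order moves, so iterated derivatives stay within one
family. -/
theorem hasDerivAt_hankelTransform (hk : -1 / 2 ≤ k) (hf : IsSchwartz f) (y : ℝ) :
    HasDerivAt (hankelTransform k f) (-(y * hankelTransform (k + 1) f y)) y := by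
  have hk1 : (k : ℂ) + 1 ≠ 0 := by exact_mod_cast (by linarith : k + 1 ≠ 0)
  have hk' : -1 / 2 ≤ k + 1 := by linarith
  have h : HasDerivAt (hankelTransform k f) (∫ x : ℝ, (x * f x) *
      ((-((x * y) / (2 * (k + 1)) * besselJ (k + 1) (x * y)) : ℝ) : ℂ) ∂(dunklMeasure k)) y := by
    refine (hasDerivAt_integral_of_dominated_loc_of_deriv_le (𝕜 := ℝ) (s := Set.univ)
      (F := fun y (x : ℝ) => f x * besselJ k (x * y))
      (F' := fun y (x : ℝ) => (x * f x) *
        ((-((x * y) / (2 * (k + 1)) * besselJ (k + 1) (x * y)) : ℝ) : ℂ))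
      (bound := fun x : ℝ => ‖(x : ℂ) * f x‖) Filter.univ_mem ?_ ?_ ?_ ?_ ?_ ?_).2
    · exact Filter.Eventually.of_forall fun y =>
        (hf.continuous.mul (continuous_besselJ_mul hk y)).aestronglyMeasurable
    · exact integrable_mul_besselJ hk hf y
    · refine (hf.id_mul.continuous.mul (Complex.continuous_ofReal.comp ?_)).aestronglyMeasurable
      exact (Continuous.mul (by fun_prop)
        ((continuous_besselJ hk').comp (by fun_prop : Continuous fun x : ℝ => x * y))).neg
    · refine Filter.Eventually.of_forall fun x y _ => ?_
      rw [norm_mul, Complex.norm_real, norm_neg]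
      exact mul_le_of_le_one_right (norm_nonneg _) (abs_deriv_besselJ_le_one hk _)
    · exact (hf.id_mul.integrable hk).norm
    · refine Filter.Eventually.of_forall fun x y _ => ?_
      have h1 : HasDerivAt (fun y : ℝ => x * y) x y := by
        simpa using (hasDerivAt_id y).const_mul x
      convert! (((hasDerivAt_besselJ hk (x * y)).scomp y h1).ofReal_comp).const_mul (f x) using 1
      simp only [smul_eq_mul]
      push_cast
      ring
  convert! h using 1
  have h2 := integral_dunklMeasure_succ hk fun x => f x * besselJ (k + 1) (x * y)
  rw [hankelTransform, ← mul_right_inj' (mul_ne_zero two_ne_zero hk1), mul_neg, mul_left_comm, h2,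
    ← integral_const_mul, ← integral_const_mul, ← integral_neg]
  congr 1 with x
  push_cast
  field_simp

/-- The even part of the kernel gives the first term. Its odd part sees only the odd part of $f$,
which is $x$ times the odd quotient, and $x^2\,d\mu_k$ again raises the order. -/
theorem dunklTransform_eq_hankelTransform (hk : -1 / 2 ≤ k) (hf : IsSchwartz f) (y : ℝ) :
    dunklTransform k f y =
      hankelTransform k f y - Complex.I * (y * hankelTransform (k + 1) (oddQuotient f) y) := by
  have hk1 : (k : ℂ) + 1 ≠ 0 := by exact_mod_cast (by linarith : k + 1 ≠ 0)
  have hk' : -1 / 2 ≤ k + 1 := by linarith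
  have h1 := integral_dunklMeasure_succ hk fun x => oddQuotient f x * besselJ (k + 1) (x * y)
  have h2 : Integrable (fun x : ℝ => (x * f x) * besselJ (k + 1) (x * y)) (dunklMeasure k) :=
    hf.id_mul.integrable_mul hk (continuous_besselJ_mul hk' y) fun _ => norm_besselJ_le_one hk' _
  have h3 : ∫ x : ℝ, (x * f x) * besselJ (k + 1) (x * y) ∂(dunklMeasure k) =
      2 * (k + 1) * hankelTransform (k + 1) (oddQuotient f) y := by
    have h4 := integral_comp_neg_dunklMeasure hk
      fun x : ℝ => (x * f x) * (besselJ (k + 1) (x * y) : ℂ)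
    have h5 : Integrable (fun x : ℝ => ((-x : ℝ) * f (-x)) * (besselJ (k + 1) (-x * y) : ℂ))
        (dunklMeasure k) := by
      have := (hf.comp_neg.id_mul.const_mul (-1)).integrable_mul hk (continuous_besselJ_mul hk' y)
        fun _ => norm_besselJ_le_one hk' _
      refine this.congr (Filter.Eventually.of_forall fun x => ?_)
      simp only [neg_mul, besselJ_neg]
      push_cast
      ring
    rw [hankelTransform, h1]
    calc ∫ x : ℝ, (x * f x) * besselJ (k + 1) (x * y) ∂(dunklMeasure k)
        = 1 / 2 * (∫ x : ℝ, (x * f x) * besselJ (k + 1) (x * y) ∂(dunklMeasure k) +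
            ∫ x : ℝ, ((-x : ℝ) * f (-x)) * (besselJ (k + 1) (-x * y) : ℂ) ∂(dunklMeasure k)) := by
          rw [h4]
          ring
      _ = _ := by
          rw [← integral_add h2 h5, ← integral_const_mul]
          congr 1 with x
          have h6 := two_mul_oddQuotient f x
          simp only [neg_mul, besselJ_neg]
          push_cast
          linear_combination (-x / 2 * besselJ (k + 1) (x * y)) * h6
  have h7 : dunklTransform k f y = ∫ x : ℝ, f x * besselJ k (x * y) +
      (-(Complex.I * y) / (2 * (k + 1))) * ((x * f x) * besselJ (k + 1) (x * y))
      ∂(dunklMeasure k) := by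
    rw [dunklTransform]
    congr 1 with x
    simp only [dunklExp, besselJ_neg]
    push_cast
    field_simp
  rw [h7, integral_add (integrable_mul_besselJ hk hf y) (h2.const_mul _), integral_const_mul, h3,
    ← hankelTransform]
  field_simp
  ring

/-- All the requirements of `isSchwartz_of_class` pass to linear combinations, so they need checking
only on generators. -/
theorem isSchwartz_of_span {S : Set (ℝ → ℂ)} (hdiff : ∀ f ∈ S, Differentiable ℝ f)
    (hderiv : ∀ f ∈ S, deriv f ∈ Submodule.span ℂ S)
    (hmul : ∀ f ∈ S, (fun x : ℝ => (x : ℂ) * f x) ∈ Submodule.span ℂ S)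
    (hbdd : ∀ f ∈ S, ∃ C : ℝ, ∀ x, ‖f x‖ ≤ C) (hf : f ∈ Submodule.span ℂ S) : IsSchwartz f := by
  have hd : ∀ f ∈ Submodule.span ℂ S, Differentiable ℝ f := by
    intro f hf
    induction hf using Submodule.span_induction with
    | mem f hf => exact hdiff f hf
    | zero => exact differentiable_const 0
    | add f g _ _ hf hg => exact hf.add hg
    | smul c f _ hf => exact hf.const_smul c
  refine isSchwartz_of_class (Submodule.span ℂ S : Set (ℝ → ℂ)) hd ?_ ?_ ?_ hf
  · intro f hf
    induction hf using Submodule.span_induction with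
    | mem f hf => exact hderiv f hf
    | zero => simp
    | add f g hf hg hf' hg' =>
      have : deriv (f + g) = deriv f + deriv g := funext fun x => deriv_add (hd f hf x) (hd g hg x)
      rw [this]
      exact add_mem hf' hg'
    | smul c f hf hf' =>
      have : deriv (c • f) = c • deriv f := funext fun x => deriv_const_smul c (hd f hf x)
      rw [this]
      exact Submodule.smul_mem _ c hf'
  · intro f hf
    induction hf using Submodule.span_induction with
    | mem f hf => exact hmul f hf
    | zero =>
      convert! (Submodule.span ℂ S).zero_mem using 2 with x
      simp
    | add f g hf hg hf' hg' =>
      convert! add_mem hf' hg' using 2 with x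
      simp [mul_add]
    | smul c f hf hf' =>
      convert! Submodule.smul_mem _ c hf' using 2 with x
      simp [mul_left_comm]
  · intro f hf
    induction hf using Submodule.span_induction with
    | mem f hf => exact hbdd f hf
    | zero => exact ⟨0, by simp⟩
    | add f g hf hg hf' hg' =>
      obtain ⟨C, hC⟩ := hf'
      obtain ⟨D, hD⟩ := hg'
      exact ⟨C + D, fun x => (norm_add_le _ _).trans (add_le_add (hC x) (hD x))⟩
    | smul c f hf hf' =>
      obtain ⟨C, hC⟩ := hf'
      refine ⟨‖c‖ * C, fun x => ?_⟩
      rw [Pi.smul_apply, norm_smul]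
      gcongr
      exact hC x

theorem isSchwartz_hankelTransform (hk : -1 / 2 ≤ k) (hf : IsSchwartz f) :
    IsSchwartz (hankelTransform k f) := by
  -- The order varies within the class, since differentiation raises it.
  set S : Set (ℝ → ℂ) := {h | ∃ (n : ℕ) (k : ℝ) (f : ℝ → ℂ), -1 / 2 ≤ k ∧ IsSchwartz f ∧
    h = fun y : ℝ => (y : ℂ) ^ n * hankelTransform k f y}
  have hS : ∀ (n : ℕ) {k : ℝ} {f : ℝ → ℂ}, -1 / 2 ≤ k → IsSchwartz f →
      (fun y : ℝ => (y : ℂ) ^ n * hankelTransform k f y) ∈ S :=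
    fun n {k f} hk hf => ⟨n, k, f, hk, hf, rfl⟩
  -- For $n=0$ the truncated exponent $n-1$ is harmless, as its term has the factor $n$.
  have hD : ∀ (n : ℕ) {k : ℝ} {f : ℝ → ℂ}, -1 / 2 ≤ k → IsSchwartz f → ∀ y : ℝ,
      HasDerivAt (fun y : ℝ => (y : ℂ) ^ n * hankelTransform k f y)
        (n * (y ^ (n - 1) * hankelTransform k f y) -
          y ^ (n + 1) * hankelTransform (k + 1) f y) y := by
    intro n k f hk hf y
    have h1 : HasDerivAt (fun y : ℝ => (y : ℂ) ^ n) (n * (y : ℂ) ^ (n - 1)) y := by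
      simpa using! (hasDerivAt_pow n (y : ℂ)).comp_ofReal
    convert! h1.fun_mul (hasDerivAt_hankelTransform hk hf y) using 1
    ring
  refine isSchwartz_of_span (S := S) ?_ ?_ ?_ ?_
    (Submodule.subset_span (by simpa using hS 0 hk hf))
  · rintro _ ⟨n, k, f, hk, hf, rfl⟩ y
    exact (hD n hk hf y).differentiableAt
  · rintro _ ⟨n, k, f, hk, hf, rfl⟩
    have := sub_mem (Submodule.smul_mem _ (n : ℂ) (Submodule.subset_span (R := ℂ) (hS (n - 1) hk hf)))
      (Submodule.subset_span (R := ℂ) (hS (n + 1) (by linarith : -1 / 2 ≤ k + 1) hf))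
    convert! this using 1
    ext y
    rw [(hD n hk hf y).deriv]
    simp
  · rintro _ ⟨n, k, f, hk, hf, rfl⟩
    refine Submodule.subset_span ?_
    convert! hS (n + 1) hk hf using 2 with y
    ring
  · rintro _ ⟨n, k, f, hk, hf, rfl⟩
    exact exists_norm_pow_mul_hankelTransform_le hk n hf

theorem IsSchwartz.dunklTransform (hk : -1 / 2 ≤ k) (hf : IsSchwartz f) :
    IsSchwartz (dunklTransform k f) := by
  rw [funext (dunklTransform_eq_hankelTransform hk hf)]
  exact (isSchwartz_hankelTransform hk hf).sub ((isSchwartz_hankelTransform (by linarith)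
    hf.oddQuotient).id_mul.const_mul _)

end

/-! ### The Gaussian -/

/-- The Gaussian `exp (-x² / 2)`. -/
def gaussian (x : ℝ) : ℂ := (Real.exp (-x ^ 2 / 2) : ℂ)

theorem gaussian_ne_zero (x : ℝ) : gaussian x ≠ 0 := by
  simp [gaussian]

theorem gaussian_neg (x : ℝ) : gaussian (-x) = gaussian x := by simp [gaussian]

theorem hasDerivAt_gaussian (x : ℝ) : HasDerivAt gaussian (-(x * gaussian x)) x := by
  have h : HasDerivAt (fun x : ℝ => -x ^ 2 / 2) (-x) x := by
    convert! (hasDerivAt_pow 2 x).fun_neg.div_const 2 using 1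
    norm_num
    ring
  convert! h.exp.ofReal_comp using 1
  rw [gaussian]
  push_cast
  ring

theorem exists_norm_pow_mul_gaussian_le (n : ℕ) :
    ∃ C : ℝ, ∀ x : ℝ, ‖(x : ℂ) ^ n * gaussian x‖ ≤ C := by
  -- The constant comes from $|x|^n\le1+x^{2n}$ and $x^{2n}\le2^nn!\,e^{x^2/2}$.
  refine ⟨1 + 2 ^ n * n.factorial, fun x => ?_⟩
  rw [norm_mul, norm_pow, gaussian, Complex.norm_real, Complex.norm_real,
    Real.norm_of_nonneg (Real.exp_pos _).le, Real.norm_eq_abs]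
  have h1 := Real.pow_div_factorial_le_exp (x ^ 2 / 2) (by positivity) n
  have h2 : Real.exp (x ^ 2 / 2) * Real.exp (-x ^ 2 / 2) = 1 := by
    rw [← Real.exp_add]
    simp [neg_div]
  have h3 : Real.exp (-x ^ 2 / 2) ≤ 1 := Real.exp_le_one_iff.2 (by nlinarith [sq_nonneg x])
  have h4 : |x| ^ n ≤ 1 + (x ^ 2) ^ n := by
    rw [← sq_abs, pow_right_comm]
    nlinarith [sq_nonneg (|x| ^ n - 1)]
  have h5 : (x ^ 2) ^ n ≤ 2 ^ n * n.factorial * Real.exp (x ^ 2 / 2) := by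
    rw [div_pow, div_div, div_le_iff₀ (by positivity)] at h1
    linarith
  have h6 := Real.exp_pos (-x ^ 2 / 2)
  calc |x| ^ n * Real.exp (-x ^ 2 / 2)
      ≤ (1 + 2 ^ n * n.factorial * Real.exp (x ^ 2 / 2)) * Real.exp (-x ^ 2 / 2) := by
        gcongr
        linarith
    _ = Real.exp (-x ^ 2 / 2) +
        2 ^ n * n.factorial * (Real.exp (x ^ 2 / 2) * Real.exp (-x ^ 2 / 2)) := by ring
    _ ≤ _ := by
        rw [h2, mul_one]
        linarith

theorem isSchwartz_gaussian : IsSchwartz gaussian := by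
  set S : Set (ℝ → ℂ) := Set.range fun (n : ℕ) (x : ℝ) => (x : ℂ) ^ n * gaussian x
  have hS : ∀ n : ℕ, (fun x : ℝ => (x : ℂ) ^ n * gaussian x) ∈ S := fun n => ⟨n, rfl⟩
  have hD : ∀ (n : ℕ) (x : ℝ), HasDerivAt (fun x : ℝ => (x : ℂ) ^ n * gaussian x)
      (n * (x ^ (n - 1) * gaussian x) - x ^ (n + 1) * gaussian x) x := by
    intro n x
    have h1 : HasDerivAt (fun y : ℝ => (y : ℂ) ^ n) (n * (x : ℂ) ^ (n - 1)) x := by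
      simpa using! (hasDerivAt_pow n (x : ℂ)).comp_ofReal
    convert! h1.fun_mul (hasDerivAt_gaussian x) using 1
    ring
  refine isSchwartz_of_span (S := S) ?_ ?_ ?_ ?_ (Submodule.subset_span (by simpa using hS 0))
  · rintro _ ⟨n, rfl⟩ x
    exact (hD n x).differentiableAt
  · rintro _ ⟨n, rfl⟩
    have := sub_mem (Submodule.smul_mem _ (n : ℂ) (Submodule.subset_span (R := ℂ) (hS (n - 1))))
      (Submodule.subset_span (R := ℂ) (hS (n + 1)))
    convert! this using 1
    ext x
    rw [(hD n x).deriv]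
    simp
  · rintro _ ⟨n, rfl⟩
    refine Submodule.subset_span ?_
    convert! hS (n + 1) using 2 with x
    ring
  · rintro _ ⟨n, rfl⟩
    exact exists_norm_pow_mul_gaussian_le n

theorem oddQuotient_of_even {f : ℝ → ℂ} (hf : ∀ x, f (-x) = f x) (x : ℝ) :
    oddQuotient f x = 0 := by
  rcases eq_or_ne x 0 with rfl | hx
  · have h := deriv_comp_neg f 0
    rw [funext hf, neg_zero] at h
    rw [oddQuotient_zero]
    exact self_eq_neg.1 h
  · rw [oddQuotient_of_ne f hx, hf, sub_self, zero_div]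

section

variable {k : ℝ} {f g : ℝ → ℂ}

theorem integral_gaussian_dunklMeasure (hk : -1 / 2 ≤ k) :
    ∫ x, gaussian x ∂(dunklMeasure k) = 1 := by
  have hK := (dunklWeight_const_pos hk).ne'
  rw [integral_dunklMeasure_eq_Ioi hk (isSchwartz_gaussian.integrable hk)]
  have h1 := integral_rpow_mul_exp_neg_mul_rpow (p := 2) (q := 2 * k + 1) (b := 1 / 2)
    (by norm_num) (by linarith) (by norm_num)
  have h2 : ∫ x in Set.Ioi (0 : ℝ), (dunklWeight k x : ℂ) * (gaussian x + gaussian (-x)) =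
      ((2 / (2 ^ (k + 1) * Real.Gamma (k + 1)) * ∫ x in Set.Ioi (0 : ℝ),
        x ^ (2 * k + 1) * Real.exp (-(1 / 2) * x ^ (2 : ℝ)) : ℝ) : ℂ) := by
    rw [← integral_const_mul, ← integral_complex_ofReal]
    refine setIntegral_congr_fun measurableSet_Ioi fun x hx => ?_
    rw [gaussian_neg, gaussian, dunklWeight, abs_of_pos hx, Real.rpow_two,
      show -(1 / 2) * x ^ 2 = -x ^ 2 / 2 by ring]
    push_cast
    ring
  rw [h2, h1, show (2 * k + 1 + 1) / 2 = k + 1 by ring, show -(2 * k + 1 + 1) / 2 = -(k + 1) by ring,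
    Real.rpow_neg (by norm_num), Real.div_rpow (by norm_num) (by norm_num), Real.one_rpow, one_div,
    inv_inv]
  norm_cast
  field_simp
  exact div_self (Real.Gamma_pos_of_pos (by linarith)).ne'

/-- The Gaussian is even and satisfies $\Lambda_k\gamma=-x\gamma$. The transform exchanges the two
sides of this equation, so the transform of $\gamma$ solves $u'=-yu$ as well; the normalization of
$\mu_k$ gives the value $1$ at $0$. -/
theorem dunklTransform_gaussian (hk : -1 / 2 ≤ k) : dunklTransform k gaussian = gaussian := by
  have hγ := isSchwartz_gaussian
  have hF := hγ.dunklTransform hk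
  have heven : ∀ y, dunklTransform k gaussian (-y) = dunklTransform k gaussian y := fun y => by
    rw [← dunklTransform_comp_neg hk]
    simp only [gaussian_neg]
  have h1 : dunklOp k gaussian = fun x : ℝ => (-1 : ℂ) * (x * gaussian x) := by
    ext x
    rw [dunklOp_apply, oddQuotient_of_even gaussian_neg, (hasDerivAt_gaussian x).deriv]
    ring
  have h2 : ∀ y, deriv (dunklTransform k gaussian) y = -(y * dunklTransform k gaussian y) := by
    intro y
    have h3 := dunklOp_dunklTransform hk hγ y
    have h4 := dunklTransform_dunklOp hk hγ y
    rw [dunklOp_apply, oddQuotient_of_even heven, mul_zero, add_zero] at h3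
    rw [h1, dunklTransform_const_mul] at h4
    rw [h3]
    linear_combination Complex.I * h4 + y * dunklTransform k gaussian y * Complex.I_sq
  set q : ℝ → ℂ := fun y => dunklTransform k gaussian y / gaussian y
  have hq : ∀ y, HasDerivAt q 0 y := by
    intro y
    convert! (hF.hasDerivAt y).fun_div (hasDerivAt_gaussian y) (gaussian_ne_zero y) using 1
    rw [h2]
    ring
  have h5 : ∀ y, q y = q 0 := fun y =>
    is_const_of_deriv_eq_zero (fun y => (hq y).differentiableAt) (fun y => (hq y).deriv) y 0
  have h6 : q 0 = 1 := by
    have : dunklTransform k gaussian 0 = 1 := by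
      simpa [dunklTransform, dunklExp_zero hk] using integral_gaussian_dunklMeasure hk
    simp only [q]
    rw [this]
    simp [gaussian]
  ext y
  have h7 := (h5 y).trans h6
  rwa [div_eq_one_iff_eq (gaussian_ne_zero y)] at h7

/-! ### Inversion and Plancherel formula -/

/-- The square of the transform anticommutes with multiplication by the variable, as the reflection
does. Together with the Gaussian this determines it. -/
theorem dunklTransform_dunklTransform_id_mul (hk : -1 / 2 ≤ k) (hf : IsSchwartz f) (y : ℝ) :
    dunklTransform k (dunklTransform k fun x : ℝ => (x : ℂ) * f x) y =
      -(y * dunklTransform k (dunklTransform k f) y) := by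
  have h1 : (dunklTransform k fun x : ℝ => (x : ℂ) * f x) =
      fun y => Complex.I * dunklOp k (dunklTransform k f) y := by
    ext y
    rw [dunklOp_dunklTransform hk hf, ← mul_assoc, mul_neg, Complex.I_mul_I, neg_neg, one_mul]
  rw [h1, dunklTransform_const_mul, dunklTransform_dunklOp hk (hf.dunklTransform hk)]
  linear_combination y * dunklTransform k (dunklTransform k f) y * Complex.I_sq

/-- Inversion formula for the Dunkl transform. -/
theorem dunklTransform_dunklTransform (hk : -1 / 2 ≤ k) (hf : IsSchwartz f) (y : ℝ) :
    dunklTransform k (dunklTransform k f) y = f (-y) := by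
  set a := -y
  -- With $a=-y$, subtracting $c\gamma$ makes the remainder vanish at $a$, hence equal to
  -- $(x-a)\chi$ with $\chi$ Schwartz. The double transform sends $(x-a)\chi$ to a function with
  -- factor $-(y+a)=0$ at $y$, and fixes $c\gamma$.
  set c := f a / gaussian a
  have hd : IsSchwartz fun x => f x + -c * gaussian x :=
    hf.add (isSchwartz_gaussian.const_mul (-c))
  have hda : f a + -c * gaussian a = 0 := by
    simp only [c]
    rw [neg_mul, div_mul_cancel₀ _ (gaussian_ne_zero a), add_neg_cancel]
  have hχ := hd.dslope hda
  set χ := dslope (fun x => f x + -c * gaussian x) a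
  have hfχ : f = fun x => c * gaussian x + ((x : ℂ) * χ x + -a * χ x) := by
    ext x
    have h := sub_smul_dslope (fun x => f x + -c * gaussian x) a x
    rw [Complex.real_smul, hda] at h
    push_cast at h
    linear_combination -h
  have h1 : dunklTransform k f = fun y => c * gaussian y +
      ((dunklTransform k fun x : ℝ => (x : ℂ) * χ x) y + -a * dunklTransform k χ y) := by
    ext y
    conv_lhs => rw [hfχ]
    rw [dunklTransform_add hk (isSchwartz_gaussian.const_mul c) (hχ.id_mul.add (hχ.const_mul (-a))),
      dunklTransform_add hk hχ.id_mul (hχ.const_mul (-a)), dunklTransform_const_mul,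
      dunklTransform_const_mul, dunklTransform_gaussian hk]
  have h2 := hχ.dunklTransform hk
  have h3 := hχ.id_mul.dunklTransform hk
  rw [h1, dunklTransform_add hk (isSchwartz_gaussian.const_mul c) (h3.add (h2.const_mul (-a))),
    dunklTransform_add hk h3 (h2.const_mul (-a)), dunklTransform_const_mul,
    dunklTransform_const_mul, dunklTransform_gaussian hk,
    dunklTransform_dunklTransform_id_mul hk hχ, ← gaussian_neg]
  simp only [a, c]
  rw [div_mul_cancel₀ _ (gaussian_ne_zero _)]
  push_cast
  ring

instance (k : ℝ) : SFinite (dunklMeasure k) := by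
  unfold dunklMeasure
  infer_instance

/-- The Dunkl transform is symmetric for the bilinear pairing. -/
theorem integral_dunklTransform_mul (hk : -1 / 2 ≤ k) (hf : IsSchwartz f) (hg : IsSchwartz g) :
    ∫ y, dunklTransform k f y * g y ∂(dunklMeasure k) =
      ∫ x, f x * dunklTransform k g x ∂(dunklMeasure k) := by
  have hint : Integrable (Function.uncurry fun y x : ℝ => f x * dunklExp k (-(x * y)) * g y)
      ((dunklMeasure k).prod (dunklMeasure k)) := by
    have h1 := ((hg.integrable hk).mul_prod (hf.integrable hk)).mul_bdd
      (g := fun z : ℝ × ℝ => dunklExp k (-(z.2 * z.1))) (c := 1)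
      ((continuous_dunklExp hk).comp (by fun_prop)).aestronglyMeasurable
      (Filter.Eventually.of_forall fun z => norm_dunklExp_le_one hk _)
    refine h1.congr (Filter.Eventually.of_forall fun z => ?_)
    simp only [Function.uncurry]
    ring
  calc ∫ y, dunklTransform k f y * g y ∂(dunklMeasure k)
      = ∫ y, ∫ x, f x * dunklExp k (-(x * y)) * g y ∂(dunklMeasure k) ∂(dunklMeasure k) := by
        simp only [dunklTransform, integral_mul_const]
    _ = ∫ x, ∫ y, f x * dunklExp k (-(x * y)) * g y ∂(dunklMeasure k) ∂(dunklMeasure k) :=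
        integral_integral_swap hint
    _ = _ := by
        congr 1 with x
        rw [dunklTransform, ← integral_const_mul]
        congr 1 with y
        rw [mul_comm x y]
        ring

/-- Plancherel formula for the Dunkl transform. -/
theorem integral_dunklTransform_mul_conj (hk : -1 / 2 ≤ k) (hf : IsSchwartz f)
    (hg : IsSchwartz g) :
    ∫ y, dunklTransform k f y * conj (dunklTransform k g y) ∂(dunklMeasure k) =
      ∫ x, f x * conj (g x) ∂(dunklMeasure k) := by
  have h1 := (hg.star.dunklTransform hk).comp_neg
  simp only [conj_dunklTransform]
  rw [integral_dunklTransform_mul hk hf h1]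
  congr 1 with x
  rw [dunklTransform_comp_neg hk, dunklTransform_dunklTransform hk hg.star, neg_neg]

end

/-! ### The linear canonical Dunkl transform on Schwartz functions -/

/-- The composition of the Dunkl transform with a dilation and two chirps of which `lcdt` and
`lcdtTranspose` are instances. -/
def lcTransform (k α β b : ℝ) (f : ℝ → ℂ) (y : ℝ) : ℂ :=
  1 / (Complex.I * b) ^ ((k + 1 : ℝ) : ℂ) *
    (chirp α y * dunklTransform k (fun x => chirp β x * f x) (y / b))

theorem lcKernel_eq (k : ℝ) (M : Matrix.SpecialLinearGroup (Fin 2) ℝ) (l x : ℝ) :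
    lcKernel k M l x = chirp (M 1 1 / M 0 1) l * chirp (M 0 0 / M 0 1) x *
      dunklExp k (-(x * (l / M 0 1))) := by
  rw [lcKernel, dunklKernel_eq, chirp, chirp, ← Complex.exp_add, ← mul_add, ← Complex.ofReal_add,
    show -l / M 0 1 * x = -(x * (l / M 0 1)) by ring]

theorem lcdt_eq (k : ℝ) (M : Matrix.SpecialLinearGroup (Fin 2) ℝ) (f : ℝ → ℂ) (l : ℝ) :
    lcdt k M f l = lcTransform k (M 1 1 / M 0 1) (M 0 0 / M 0 1) (M 0 1) f l := by
  rw [lcdt, lcTransform, dunklTransform]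
  congr 1
  rw [← integral_const_mul]
  congr 1 with x
  rw [lcKernel_eq]
  ring

theorem lcdtTranspose_eq (k : ℝ) (M : Matrix.SpecialLinearGroup (Fin 2) ℝ) (f : ℝ → ℂ) (x : ℝ) :
    lcdtTranspose k M f x = lcTransform k (M 0 0 / M 0 1) (M 1 1 / M 0 1) (M 0 1) f x := by
  rw [lcdtTranspose, lcTransform, dunklTransform]
  congr 1
  rw [← integral_const_mul]
  congr 1 with l
  rw [lcKernel_eq, show x * (l / M 0 1) = l * (x / M 0 1) by ring]
  ring

theorem lcConst_ne_zero {b : ℝ} (hb : b ≠ 0) (s : ℂ) : (Complex.I * b) ^ s ≠ 0 := by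
  simp [Complex.cpow_eq_zero_iff, hb]

section

variable {k α β b : ℝ} {f g : ℝ → ℂ}

theorem IsSchwartz.lcTransform (hk : -1 / 2 ≤ k) (hb : b ≠ 0) (hf : IsSchwartz f) :
    IsSchwartz (lcTransform k α β b f) := by
  have h := ((((hf.chirp_mul β).dunklTransform hk).comp_mul_left (inv_ne_zero hb)).chirp_mul
    α).const_mul (1 / (Complex.I * b) ^ ((k + 1 : ℝ) : ℂ))
  convert! h using 2 with y
  rw [LCDunkl.lcTransform, div_eq_inv_mul y]

theorem lcTransform_add (hk : -1 / 2 ≤ k) (hf : IsSchwartz f) (hg : IsSchwartz g) (y : ℝ) :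
    lcTransform k α β b (fun x => f x + g x) y =
      lcTransform k α β b f y + lcTransform k α β b g y := by
  simp only [lcTransform, mul_add]
  rw [dunklTransform_add hk (hf.chirp_mul β) (hg.chirp_mul β)]
  ring

theorem lcTransform_const_mul (c : ℂ) (y : ℝ) :
    lcTransform k α β b (fun x => c * f x) y = c * lcTransform k α β b f y := by
  simp only [lcTransform, mul_left_comm _ c]
  rw [dunklTransform_const_mul]
  ring

/-- Each factor is undone in turn: opposite chirps, the inverse dilation, and the reflected Dunkl
transform. -/
theorem exists_lcTransform_eq (hk : -1 / 2 ≤ k) (hb : b ≠ 0) (hg : IsSchwartz g) :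
    ∃ f, IsSchwartz f ∧ lcTransform k α β b f = g := by
  set c : ℂ := (Complex.I * b) ^ ((k + 1 : ℝ) : ℂ)
  have hc : c ≠ 0 := lcConst_ne_zero hb _
  have hh : IsSchwartz fun y => c * (chirp (-α) (b * y) * g (b * y)) :=
    ((hg.chirp_mul (-α)).comp_mul_left hb).const_mul c
  set h : ℝ → ℂ := fun y => c * (chirp (-α) (b * y) * g (b * y))
  have hF := (hh.dunklTransform hk).comp_neg
  refine ⟨_, hF.chirp_mul (-β), funext fun y => ?_⟩
  rw [lcTransform]
  have h1 : (fun x => chirp β x * (chirp (-β) x * dunklTransform k h (-x))) =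
      fun x => dunklTransform k h (-x) := by
    ext x
    rw [← mul_assoc, mul_comm (chirp β x), chirp_neg_mul_chirp, one_mul]
  rw [h1, dunklTransform_comp_neg hk, dunklTransform_dunklTransform hk hh, neg_neg]
  simp only [h]
  have h2 : 1 / c * c = 1 := one_div_mul_cancel hc
  rw [mul_div_cancel₀ y hb]
  linear_combination (1 / c * c * g y) * chirp_neg_mul_chirp α y + g y * h2

theorem integral_comp_div_dunklMeasure (hk : -1 / 2 ≤ k) (hb : b ≠ 0) (g : ℝ → ℂ) :
    ∫ x, g (x / b) ∂(dunklMeasure k) =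
      ((|b| ^ (2 * (k + 1)) : ℝ) : ℂ) * ∫ x, g x ∂(dunklMeasure k) := by
  have h := integral_comp_mul_dunklMeasure hk g (inv_ne_zero hb)
  rw [abs_inv, Real.inv_rpow (abs_nonneg b), inv_inv] at h
  simpa only [div_eq_inv_mul] using h

/-- The transform `lcTransform` is isometric for the norm of `L²_k`. -/
theorem integral_lcTransform_mul_conj (hk : -1 / 2 ≤ k) (hb : b ≠ 0) (hf : IsSchwartz f)
    (hg : IsSchwartz g) :
    ∫ y, lcTransform k α β b f y * conj (lcTransform k α β b g y) ∂(dunklMeasure k) =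
      ∫ x, f x * conj (g x) ∂(dunklMeasure k) := by
  set c : ℂ := (Complex.I * b) ^ ((k + 1 : ℝ) : ℂ)
  -- The squared modulus of the normalizing constant is exactly the Jacobian of the dilation
  -- $y\mapsto y/b$ for $\mu_k$.
  have hc : c * conj c = ((|b| ^ (2 * (k + 1)) : ℝ) : ℂ) := by
    rw [Complex.mul_conj, Complex.normSq_eq_norm_sq, Complex.norm_cpow_real, norm_mul,
      Complex.norm_I, one_mul, Complex.norm_real, Real.norm_eq_abs, mul_comm 2 (k + 1),
      Real.rpow_mul (abs_nonneg b), Real.rpow_two]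
  have hb' : ((|b| ^ (2 * (k + 1)) : ℝ) : ℂ) ≠ 0 := by
    exact_mod_cast (Real.rpow_pos_of_pos (abs_pos.2 hb) _).ne'
  have hchirp : ∀ a x : ℝ, chirp a x * conj (chirp a x) = 1 := fun a x => by
    rw [conj_chirp, mul_comm, chirp_neg_mul_chirp]
  set F := dunklTransform k fun x => chirp β x * f x
  set G := dunklTransform k fun x => chirp β x * g x
  calc ∫ y, lcTransform k α β b f y * conj (lcTransform k α β b g y) ∂(dunklMeasure k)
      = ∫ y, (1 / (c * conj c)) * (F (y / b) * conj (G (y / b))) ∂(dunklMeasure k) := by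
        congr 1 with y
        simp only [lcTransform, map_mul, map_div₀, map_one]
        linear_combination (1 / c * (1 / conj c) * F (y / b) * conj (G (y / b))) * hchirp α y
    _ = ∫ y, F y * conj (G y) ∂(dunklMeasure k) := by
        rw [integral_const_mul, integral_comp_div_dunklMeasure hk hb fun y => F y * conj (G y), hc,
          ← mul_assoc, one_div_mul_cancel hb', one_mul]
    _ = ∫ x, f x * conj (g x) ∂(dunklMeasure k) := by
        rw [integral_dunklTransform_mul_conj hk (hf.chirp_mul β) (hg.chirp_mul β)]
        congr 1 with x
        rw [map_mul]
        linear_combination f x * conj (g x) * hchirp β x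

theorem dunklTransform_comp_mul (hk : -1 / 2 ≤ k) (hb : b ≠ 0) (f : ℝ → ℂ) (y : ℝ) :
    ((|b| ^ (2 * (k + 1)) : ℝ) : ℂ) * dunklTransform k (fun x => f (b * x)) y =
      dunklTransform k f (y / b) := by
  rw [dunklTransform, ← integral_comp_div_dunklMeasure hk hb, dunklTransform]
  congr 1 with x
  rw [mul_div_cancel₀ x hb, div_mul_eq_mul_div, mul_div_assoc]

/-- Transposition exchanges the two chirps, as it exchanges $a/b$ and $d/b$ between `lcdt` and
`lcdtTranspose`. -/
theorem integral_lcTransform_mul (hk : -1 / 2 ≤ k) (hb : b ≠ 0) (hf : IsSchwartz f)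
    (hg : IsSchwartz g) :
    ∫ y, lcTransform k α β b f y * g y ∂(dunklMeasure k) =
      ∫ x, f x * lcTransform k β α b g x ∂(dunklMeasure k) := by
  set F := dunklTransform k fun x => chirp β x * f x
  set c : ℂ := 1 / (Complex.I * b) ^ ((k + 1 : ℝ) : ℂ)
  set G : ℝ → ℂ := fun y => chirp α y * g y
  have hG : IsSchwartz fun y => G (b * y) := (hg.chirp_mul α).comp_mul_left hb
  calc ∫ y, lcTransform k α β b f y * g y ∂(dunklMeasure k)
      = c * ∫ y, F (y / b) * G (b * (y / b)) ∂(dunklMeasure k) := by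
        rw [← integral_const_mul]
        congr 1 with y
        rw [mul_div_cancel₀ y hb, lcTransform]
        ring
    _ = c * (((|b| ^ (2 * (k + 1)) : ℝ) : ℂ) *
          ∫ x, (chirp β x * f x) * dunklTransform k (fun y => G (b * y)) x ∂(dunklMeasure k)) := by
        rw [integral_comp_div_dunklMeasure hk hb fun y => F y * G (b * y),
          integral_dunklTransform_mul hk (hf.chirp_mul β) hG]
    _ = _ := by
        rw [← integral_const_mul, ← integral_const_mul]
        congr 1 with x
        rw [lcTransform, ← dunklTransform_comp_mul hk hb]
        ring

theorem lcTransform_lcDunklOp (hk : -1 / 2 ≤ k) (M : Matrix.SpecialLinearGroup (Fin 2) ℝ)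
    (hf : IsSchwartz f) (y : ℝ) :
    lcTransform k α (M 0 0 / M 0 1) (M 0 1) (lcDunklOp k M⁻¹ f) y =
      Complex.I * ((y / M 0 1 : ℝ) : ℂ) * lcTransform k α (M 0 0 / M 0 1) (M 0 1) f y := by
  -- As $M^{-1}=(d,-b;-c,a)$, the chirp that conjugates $\Lambda_{k,M^{-1}}$ to $\Lambda_k$ is the
  -- inner chirp of the transform.
  have hM : -(M⁻¹ 1 1 / M⁻¹ 0 1) = M 0 0 / M 0 1 := by
    simp [Matrix.SpecialLinearGroup.coe_inv, Matrix.adjugate_fin_two, div_neg]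
  have h := funext (chirp_mul_lcDunklOp hf k M⁻¹)
  rw [hM] at h
  rw [lcTransform, h, dunklTransform_dunklOp hk (hf.chirp_mul _), lcTransform]
  ring

theorem lcTransform_iterate_lcDunklOp (hk : -1 / 2 ≤ k) (M : Matrix.SpecialLinearGroup (Fin 2) ℝ)
    (hf : IsSchwartz f) (n : ℕ) (y : ℝ) :
    lcTransform k α (M 0 0 / M 0 1) (M 0 1) ((lcDunklOp k M⁻¹)^[n] f) y =
      (Complex.I * ((y / M 0 1 : ℝ) : ℂ)) ^ n *
        lcTransform k α (M 0 0 / M 0 1) (M 0 1) f y := by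
  induction n with
  | zero => simp
  | succ n ih =>
    rw [Function.iterate_succ_apply', lcTransform_lcDunklOp hk M (hf.iterate_lcDunklOp k M⁻¹ n), ih]
    ring

end

/-! ### Schwartz functions in `L²_k` -/

section

variable {k : ℝ} {f g : ℝ → ℂ}

theorem dunklMeasure_isFiniteMeasureOnCompacts (hk : -1 / 2 ≤ k) :
    IsFiniteMeasureOnCompacts (dunklMeasure k) := by
  have : IsLocallyFiniteMeasure (dunklMeasure k) :=
    IsLocallyFiniteMeasure.withDensity_ofReal (continuous_dunklWeight hk)
  infer_instance

theorem IsSchwartz.memLp (hk : -1 / 2 ≤ k) (hf : IsSchwartz f) : MemLp f 2 (dunklMeasure k) := by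
  obtain ⟨φ, rfl⟩ := hf
  have := dunklMeasure_hasTemperateGrowth hk
  exact φ.memLp 2 _

/-- A Schwartz function as an element of `L²_k`. -/
def IsSchwartz.toL2 (hk : -1 / 2 ≤ k) (hf : IsSchwartz f) : L2k k := (hf.memLp hk).toLp f

theorem IsSchwartz.coeFn_toL2 (hk : -1 / 2 ≤ k) (hf : IsSchwartz f) :
    hf.toL2 hk =ᵐ[dunklMeasure k] f := MemLp.coeFn_toLp _

theorem IsSchwartz.inner_toL2 (hk : -1 / 2 ≤ k) (hf : IsSchwartz f) (h : L2k k) :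
    inner ℂ (hf.toL2 hk) h = ∫ x, h x * conj (f x) ∂(dunklMeasure k) := by
  rw [L2.inner_def]
  refine integral_congr_ae ?_
  filter_upwards [hf.coeFn_toL2 hk] with x hx
  rw [hx, RCLike.inner_apply]

theorem IsSchwartz.inner_toL2_toL2 (hk : -1 / 2 ≤ k) (hf : IsSchwartz f) (hg : IsSchwartz g) :
    inner ℂ (hf.toL2 hk) (hg.toL2 hk) = ∫ x, g x * conj (f x) ∂(dunklMeasure k) := by
  rw [hf.inner_toL2]
  refine integral_congr_ae ?_
  filter_upwards [hg.coeFn_toL2 hk] with x hx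
  rw [hx]

theorem IsSchwartz.integral_mul (hk : -1 / 2 ≤ k) (hf : IsSchwartz f) (h : L2k k) :
    ∫ x, f x * h x ∂(dunklMeasure k) = inner ℂ (hf.star.toL2 hk) h := by
  rw [hf.star.inner_toL2]
  simp only [Complex.conj_conj, mul_comm]

theorem dense_toL2 (hk : -1 / 2 ≤ k) {p : L2k k → Prop} (hp : IsClosed {h | p h})
    (H : ∀ (f : ℝ → ℂ) (hf : IsSchwartz f), p (hf.toL2 hk)) (h : L2k k) : p h := by
  have := dunklMeasure_hasTemperateGrowth hk
  have := dunklMeasure_isFiniteMeasureOnCompacts hk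
  exact DenseRange.induction_on (p := p)
    (SchwartzMap.denseRange_toLpCLM (F := ℂ) (p := 2) (μ := dunklMeasure k) ENNReal.ofNat_ne_top)
    h hp fun φ => H φ (.of_coe φ)

/-- A function is determined almost everywhere by its integrals against Schwartz functions. -/
theorem ae_eq_of_integral_schwartz_mul_eq
    (hf : ∀ φ : 𝓢(ℝ, ℂ), Integrable (fun x => φ x * f x) (dunklMeasure k))
    (hg : ∀ φ : 𝓢(ℝ, ℂ), Integrable (fun x => φ x * g x) (dunklMeasure k))
    (h : ∀ φ : 𝓢(ℝ, ℂ), ∫ x, φ x * f x ∂(dunklMeasure k) = ∫ x, φ x * g x ∂(dunklMeasure k)) :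
    f =ᵐ[dunklMeasure k] g := by
  -- Multiplication by the Gaussian makes both functions integrable, keeps compactly supported test
  -- functions Schwartz, and can be undone since the Gaussian has no zero.
  obtain ⟨γ, hγ⟩ := isSchwartz_gaussian
  have h1 : ∀ᵐ x ∂(dunklMeasure k), γ x * f x = γ x * g x := by
    refine ae_eq_of_integral_contDiff_smul_eq (hf γ).locallyIntegrable (hg γ).locallyIntegrable
      fun ρ hρ hρ' => ?_
    have h2 : HasCompactSupport fun x => (ρ x : ℂ) * γ x :=
      (hρ'.comp_left (g := fun r : ℝ => (r : ℂ)) Complex.ofReal_zero).mul_right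
    have h3 : ∫ x, ((ρ x : ℂ) * γ x) * f x ∂(dunklMeasure k) =
        ∫ x, ((ρ x : ℂ) * γ x) * g x ∂(dunklMeasure k) := h (h2.toSchwartzMap ((Complex.ofRealCLM.contDiff.comp hρ).mul (γ.smooth _)))
    simpa only [Complex.real_smul, mul_assoc] using h3
  filter_upwards [h1] with x hx
  rw [hγ] at hx
  exact mul_left_cancel₀ (gaussian_ne_zero x) hx

theorem IsSchwartz.integrable_mul_memLp (hk : -1 / 2 ≤ k) (hf : IsSchwartz f)
    (hg : MemLp g 2 (dunklMeasure k)) : Integrable (fun x => f x * g x) (dunklMeasure k) :=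
  (hf.memLp hk).integrable_mul hg

end

/-! ### The linear canonical Dunkl transform on `L²_k` -/

section

variable {k b : ℝ}

theorem eq_zero_of_lcTransform_eq_zero {α β : ℝ} {f : ℝ → ℂ} (hk : -1 / 2 ≤ k) (hb : b ≠ 0)
    (hf : IsSchwartz f) (h : lcTransform k α β b f = 0) : f = 0 := by
  have hchirp : ∀ a x : ℝ, chirp a x ≠ 0 := fun a x => Complex.exp_ne_zero _
  have h1 : dunklTransform k (fun x => chirp β x * f x) = 0 := by
    ext y
    have h2 := congrFun h (b * y)
    rw [lcTransform, mul_div_cancel_left₀ y hb] at h2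
    simpa [lcConst_ne_zero hb, hchirp] using h2
  ext x
  have h2 := dunklTransform_dunklTransform hk (hf.chirp_mul β) (-x)
  rw [h1, neg_neg] at h2
  simpa [dunklTransform, hchirp] using h2.symm

/-- `lcTransform` as a linear automorphism of the Schwartz space. -/
def lcEquiv (hk : -1 / 2 ≤ k) (α β : ℝ) (hb : b ≠ 0) : 𝓢(ℝ, ℂ) ≃ₗ[ℂ] 𝓢(ℝ, ℂ) :=
  LinearEquiv.ofBijective
    { toFun := fun φ => ((IsSchwartz.of_coe φ).lcTransform hk hb (α := α) (β := β)).choose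
      map_add' := fun φ ψ => by
        ext x
        have h := fun φ : 𝓢(ℝ, ℂ) =>
          ((IsSchwartz.of_coe φ).lcTransform hk hb (α := α) (β := β)).choose_spec
        rw [add_apply, h, h, h]
        exact lcTransform_add hk (.of_coe φ) (.of_coe ψ) x
      map_smul' := fun c φ => by
        ext x
        have h := fun φ : 𝓢(ℝ, ℂ) =>
          ((IsSchwartz.of_coe φ).lcTransform hk hb (α := α) (β := β)).choose_spec
        rw [RingHom.id_apply, smul_apply, h, h]
        exact lcTransform_const_mul c x }
    (by
      have h := fun φ : 𝓢(ℝ, ℂ) =>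
        ((IsSchwartz.of_coe φ).lcTransform hk hb (α := α) (β := β)).choose_spec
      refine ⟨(injective_iff_map_eq_zero _).2 fun φ hφ => ?_, fun ψ => ?_⟩
      · have h1 : lcTransform k α β b φ = 0 := (h φ).symm.trans (congrArg DFunLike.coe hφ)
        exact DFunLike.coe_injective (eq_zero_of_lcTransform_eq_zero hk hb (.of_coe φ) h1)
      · obtain ⟨f, ⟨φ, rfl⟩, hf⟩ := exists_lcTransform_eq (α := α) (β := β) hk hb (.of_coe ψ)
        exact ⟨φ, DFunLike.coe_injective ((h φ).trans hf)⟩)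

theorem lcEquiv_apply (hk : -1 / 2 ≤ k) (α β : ℝ) (hb : b ≠ 0) (φ : 𝓢(ℝ, ℂ)) :
    ⇑(lcEquiv hk α β hb φ) = lcTransform k α β b φ :=
  ((IsSchwartz.of_coe φ).lcTransform hk hb (α := α) (β := β)).choose_spec

/-- The transform is a bijection of the Schwartz space that preserves the $L^2_k$ norm, and Schwartz
functions are dense. -/
theorem exists_linearIsometryEquiv_lcTransform (hk : -1 / 2 ≤ k) (α β : ℝ) (hb : b ≠ 0) :
    ∃ D : L2k k ≃ₗᵢ[ℂ] L2k k, ∀ (f : ℝ → ℂ) (hf : IsSchwartz f),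
      D (hf.toL2 hk) = (hf.lcTransform hk hb (α := α) (β := β)).toL2 hk := by
  have := dunklMeasure_hasTemperateGrowth hk
  have := dunklMeasure_isFiniteMeasureOnCompacts hk
  have hdense := SchwartzMap.denseRange_toLpCLM (E := ℝ) (F := ℂ) (p := 2) (μ := dunklMeasure k)
    ENNReal.ofNat_ne_top
  have htoL2 : ∀ φ : 𝓢(ℝ, ℂ), φ.toLp 2 (dunklMeasure k) = (IsSchwartz.of_coe φ).toL2 hk :=
    fun φ => rfl
  have hnorm : ∀ φ : 𝓢(ℝ, ℂ), ‖(lcEquiv hk α β hb φ).toLp 2 (dunklMeasure k)‖ =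
      ‖φ.toLp 2 (dunklMeasure k)‖ := by
    intro φ
    rw [← sq_eq_sq₀ (norm_nonneg _) (norm_nonneg _), ← Complex.ofReal_inj]
    push_cast
    rw [← Complex.coe_algebraMap]
    have h1 := fun h : L2k k => inner_self_eq_norm_sq_to_K (𝕜 := ℂ) h
    have h2 := integral_lcTransform_mul_conj (α := α) (β := β) hk hb (.of_coe φ) (.of_coe φ)
    rw [← lcEquiv_apply hk α β hb, ← IsSchwartz.inner_toL2_toL2 hk (.of_coe _) (.of_coe _),
      ← IsSchwartz.inner_toL2_toL2 hk (.of_coe _) (.of_coe _)] at h2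
    exact ((h1 _).symm.trans h2).trans (h1 _)
  refine ⟨(lcEquiv hk α β hb).extendOfIsometry
    (SchwartzMap.toLpCLM ℂ (E := ℝ) ℂ 2 (dunklMeasure k)).toLinearMap
    (SchwartzMap.toLpCLM ℂ (E := ℝ) ℂ 2 (dunklMeasure k)).toLinearMap hdense hdense hnorm, ?_⟩
  rintro _ ⟨φ, rfl⟩
  refine ((lcEquiv hk α β hb).extendOfIsometry_eq
    (SchwartzMap.toLpCLM ℂ (E := ℝ) ℂ 2 (dunklMeasure k)).toLinearMap
    (SchwartzMap.toLpCLM ℂ (E := ℝ) ℂ 2 (dunklMeasure k)).toLinearMap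
    hdense hdense hnorm φ).trans ?_
  change (lcEquiv hk α β hb φ).toLp 2 (dunklMeasure k) = _
  rw [htoL2]
  simp only [IsSchwartz.toL2, lcEquiv_apply]

/-- The linear canonical Dunkl transform on `L²_k`. -/
def lcL2 (hk : -1 / 2 ≤ k) {M : Matrix.SpecialLinearGroup (Fin 2) ℝ} (hb : M 0 1 ≠ 0) :
    L2k k ≃ₗᵢ[ℂ] L2k k :=
  (exists_linearIsometryEquiv_lcTransform hk (M 1 1 / M 0 1) (M 0 0 / M 0 1) hb).choose

variable {M : Matrix.SpecialLinearGroup (Fin 2) ℝ} {f : ℝ → ℂ}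

theorem IsSchwartz.lcdt (hk : -1 / 2 ≤ k) (hb : M 0 1 ≠ 0) (hf : IsSchwartz f) :
    IsSchwartz (lcdt k M f) := by
  rw [funext (lcdt_eq k M f)]
  exact hf.lcTransform hk hb

theorem IsSchwartz.lcdtTranspose (hk : -1 / 2 ≤ k) (hb : M 0 1 ≠ 0) (hf : IsSchwartz f) :
    IsSchwartz (lcdtTranspose k M f) := by
  rw [funext (lcdtTranspose_eq k M f)]
  exact hf.lcTransform hk hb

theorem lcL2_toL2 (hk : -1 / 2 ≤ k) (hb : M 0 1 ≠ 0) (hf : IsSchwartz f) :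
    lcL2 hk hb (hf.toL2 hk) = (hf.lcdt hk hb).toL2 hk := by
  have h := (exists_linearIsometryEquiv_lcTransform hk (M 1 1 / M 0 1) (M 0 0 / M 0 1)
    hb).choose_spec f hf
  rw [lcL2, h]
  simp only [IsSchwartz.toL2, funext (lcdt_eq k M f)]

/-- Both sides are continuous in $h$ and agree for Schwartz $h$ by transposition. -/
theorem integral_mul_lcL2 (hk : -1 / 2 ≤ k) (hb : M 0 1 ≠ 0) (hf : IsSchwartz f) (h : L2k k) :
    ∫ x, f x * lcL2 hk hb h x ∂(dunklMeasure k) =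
      ∫ x, lcdtTranspose k M f x * h x ∂(dunklMeasure k) := by
  rw [hf.integral_mul hk, (hf.lcdtTranspose hk hb).integral_mul hk]
  refine dense_toL2 hk (p := fun h => inner ℂ (hf.star.toL2 hk) (lcL2 hk hb h) =
    inner ℂ ((hf.lcdtTranspose hk hb).star.toL2 hk) h) ?_ (fun g hg => ?_) h
  · exact isClosed_eq (continuous_const.inner (lcL2 hk hb).continuous)
      (continuous_const.inner continuous_id)
  · rw [lcL2_toL2, IsSchwartz.inner_toL2_toL2, IsSchwartz.inner_toL2_toL2]
    simp only [Complex.conj_conj, lcdt_eq, lcdtTranspose_eq]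
    exact integral_lcTransform_mul hk hb hg hf

theorem hasLCDT_toDist (hk : -1 / 2 ≤ k) (hb : M 0 1 ≠ 0) (h : L2k k) :
    HasLCDT k M (toDist hk h) (lcL2 hk hb h) := by
  refine ⟨toDist hk (lcL2 hk hb h), fun φ => ?_, fun φ => ⟨?_, toDist_apply hk _ φ⟩⟩
  · obtain ⟨ψ, hψ⟩ := (IsSchwartz.of_coe φ).lcdtTranspose hk hb
    refine ⟨ψ, fun x => congrFun hψ x, ?_⟩
    rw [toDist_apply, toDist_apply, integral_mul_lcL2 hk hb (.of_coe φ), hψ]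
  · exact (IsSchwartz.of_coe φ).integrable_mul_memLp hk (Lp.memLp _)

/-- Makes the arbitrary choice in `lcdtFun` irrelevant for integrals. -/
theorem HasLCDT.ae_eq {T : 𝓢'(ℝ, ℂ)} {g h : ℝ → ℂ} (hg : HasLCDT k M T g)
    (hh : HasLCDT k M T h) : g =ᵐ[dunklMeasure k] h := by
  obtain ⟨U, hU, hUg⟩ := hg
  obtain ⟨V, hV, hVh⟩ := hh
  refine ae_eq_of_integral_schwartz_mul_eq (fun φ => (hUg φ).1) (fun φ => (hVh φ).1) fun φ => ?_
  obtain ⟨ψ, hψ, hUψ⟩ := hU φ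
  obtain ⟨χ, hχ, hVχ⟩ := hV φ
  have : ψ = χ := SchwartzMap.ext fun x => (hψ x).trans (hχ x).symm
  rw [← (hUg φ).2, ← (hVh φ).2, hUψ, hVχ, this]

/-- A tempered distribution whose transform is in `L²_k` is in `L²_k`. -/
theorem HasLCDT.eq_toDist (hk : -1 / 2 ≤ k) (hb : M 0 1 ≠ 0) {T : 𝓢'(ℝ, ℂ)} {g : ℝ → ℂ}
    (hg : HasLCDT k M T g) (hg2 : MemLp g 2 (dunklMeasure k)) :
    T = toDist hk ((lcL2 hk hb).symm (hg2.toLp g)) := by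
  obtain ⟨U, hU, hUg⟩ := hg
  refine DFunLike.ext _ _ fun ψ => ?_
  -- Every Schwartz function is a transposed transform, so $T$ is determined by its transform.
  obtain ⟨f, hf, hfψ⟩ := exists_lcTransform_eq (α := M 0 0 / M 0 1) (β := M 1 1 / M 0 1) hk hb
    (.of_coe ψ)
  rw [← funext (lcdtTranspose_eq k M f)] at hfψ
  obtain ⟨φ, rfl⟩ := hf
  obtain ⟨χ, hχ, hUχ⟩ := hU φ
  have h1 : χ = ψ := SchwartzMap.ext fun x => (hχ x).trans (congrFun hfψ x)
  rw [← h1, ← hUχ, (hUg φ).2, toDist_apply, funext hχ,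
    ← integral_mul_lcL2 hk hb (.of_coe φ), LinearIsometryEquiv.apply_symm_apply]
  refine integral_congr_ae ?_
  filter_upwards [hg2.coeFn_toLp] with x hx
  rw [hx]

/-- The transform intertwines `Λ_{k,M⁻¹}` and the multiplication by `i x / b`. -/
theorem isWeakPow_iff (hk : -1 / 2 ≤ k) (hb : M 0 1 ≠ 0) (n : ℕ) (f g : L2k k) :
    IsWeakPow k M⁻¹ n f g ↔ lcL2 hk hb g =ᵐ[dunklMeasure k]
      fun x : ℝ => (Complex.I * ((x / M 0 1 : ℝ) : ℂ)) ^ n * lcL2 hk hb f x := by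
  have key : ∀ (φ : ℝ → ℂ), IsSchwartz φ → ∀ h : L2k k, ∫ x, h x * conj (φ x) ∂(dunklMeasure k) =
      ∫ x, conj (lcdt k M φ x) * lcL2 hk hb h x ∂(dunklMeasure k) := by
    intro φ hφ h
    rw [← hφ.inner_toL2 hk, ← (lcL2 hk hb).inner_map_map, lcL2_toL2, IsSchwartz.inner_toL2]
    simp only [mul_comm]
  -- The sign $(-1)^n$ is compensated by conjugation: $(-1)^n\,\overline{(ix/b)^n}=(ix/b)^n$.
  have hpow : ∀ φ : 𝓢(ℝ, ℂ), (-1) ^ n * ∫ x, f x * conj ((lcDunklOp k M⁻¹)^[n] φ x)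
      ∂(dunklMeasure k) = ∫ x : ℝ, conj (lcdt k M φ x) *
        ((Complex.I * ((x / M 0 1 : ℝ) : ℂ)) ^ n * lcL2 hk hb f x) ∂(dunklMeasure k) := by
    intro φ
    rw [key _ ((IsSchwartz.of_coe φ).iterate_lcDunklOp k M⁻¹ n), ← integral_const_mul]
    congr 1 with x
    rw [lcdt_eq, lcTransform_iterate_lcDunklOp hk M (.of_coe φ), map_mul, map_pow, map_mul,
      Complex.conj_I, Complex.conj_ofReal, ← mul_assoc, ← mul_assoc, ← mul_pow, lcdt_eq]
    ring
  have hiff : IsWeakPow k M⁻¹ n f g ↔ ∀ φ : 𝓢(ℝ, ℂ),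
      ∫ x, φ x * lcL2 hk hb g x ∂(dunklMeasure k) = ∫ x : ℝ, φ x *
        ((Complex.I * ((x / M 0 1 : ℝ) : ℂ)) ^ n * lcL2 hk hb f x) ∂(dunklMeasure k) := by
    constructor
    · intro h φ
      -- By surjectivity, the conjugated transforms of Schwartz functions exhaust all test
      -- functions.
      obtain ⟨_, ⟨χ, rfl⟩, hχ⟩ := exists_lcTransform_eq (α := M 1 1 / M 0 1) (β := M 0 0 / M 0 1) hk
        hb (IsSchwartz.of_coe φ).star
      have h1 := h χ
      rw [hpow, key _ (.of_coe χ)] at h1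
      simpa only [lcdt_eq, hχ, Complex.conj_conj] using h1
    · intro h φ
      rw [hpow, key _ (.of_coe φ)]
      obtain ⟨χ, hχ⟩ := ((IsSchwartz.of_coe φ).lcdt hk hb (M := M)).star
      simpa only [hχ] using h χ
  rw [hiff]
  refine ⟨fun h => ae_eq_of_integral_schwartz_mul_eq (fun φ => ?_) (fun φ => ?_) h,
    fun h φ => integral_congr_ae ?_⟩
  · exact (IsSchwartz.of_coe φ).integrable_mul_memLp hk (Lp.memLp _)
  · have h1 : ∀ m : ℕ, IsSchwartz fun x : ℝ =>
        (Complex.I * ((x / M 0 1 : ℝ) : ℂ)) ^ m * φ x := by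
      intro m
      induction m with
      | zero => simpa using IsSchwartz.of_coe φ
      | succ m ih =>
        convert! ih.id_mul.const_mul (Complex.I / M 0 1) using 2 with x
        push_cast
        ring
    refine ((h1 n).integrable_mul_memLp hk (Lp.memLp (lcL2 hk hb f))).congr
      (Filter.Eventually.of_forall fun x => ?_)
    simp only
    ring
  · filter_upwards [h] with x hx
    rw [hx]

end

/-! ### Comparison of the weights -/

/-- The base $(1+b^{-2})(1+x^2)$ dominates $(x/b)^2$ and is at least $1$, so the exponent can be
raised from $n$ to $m$. -/
theorem sq_div_pow_le (b x : ℝ) {m n : ℕ} (hn : n ≤ m) :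
    ((x / b) ^ 2) ^ n ≤ (1 + (b ^ 2)⁻¹) ^ m * (1 + x ^ 2) ^ m := by
  have hb : 0 ≤ (b ^ 2)⁻¹ := by positivity
  have h1 : (x / b) ^ 2 ≤ (1 + (b ^ 2)⁻¹) * (1 + x ^ 2) := by
    rw [div_pow, div_eq_mul_inv]
    nlinarith [sq_nonneg x]
  have h2 : 1 ≤ (1 + (b ^ 2)⁻¹) * (1 + x ^ 2) := by nlinarith [sq_nonneg x, mul_nonneg hb (sq_nonneg x)]
  calc ((x / b) ^ 2) ^ n ≤ ((1 + (b ^ 2)⁻¹) * (1 + x ^ 2)) ^ n := by gcongr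
    _ ≤ ((1 + (b ^ 2)⁻¹) * (1 + x ^ 2)) ^ m := pow_le_pow_right₀ h2 hn
    _ = _ := mul_pow _ _ _

/-- With $t=(x/b)^2$ one has $1+x^2\le(1+b^2)(1+t)$; expand $(1+t)^m$ and bound the binomial
coefficients by $2^m$. -/
theorem one_add_sq_pow_le {b : ℝ} (hb : b ≠ 0) (x : ℝ) (m : ℕ) :
    (1 + x ^ 2) ^ m ≤ (2 * (1 + b ^ 2)) ^ m * ∑ n ∈ Finset.range (m + 1), ((x / b) ^ 2) ^ n := by
  set t := (x / b) ^ 2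
  have ht : 0 ≤ t := sq_nonneg _
  have hx : x ^ 2 = b ^ 2 * t := by
    simp only [t]
    field_simp
  have h1 : 1 + x ^ 2 ≤ (1 + b ^ 2) * (t + 1) := by
    rw [hx]
    nlinarith [sq_nonneg b]
  have h2 : (t + 1) ^ m ≤ 2 ^ m * ∑ n ∈ Finset.range (m + 1), t ^ n := by
    rw [add_pow, Finset.mul_sum]
    refine Finset.sum_le_sum fun n _ => ?_
    rw [one_pow, mul_one, mul_comm]
    gcongr
    exact_mod_cast Nat.choose_le_two_pow m n
  calc (1 + x ^ 2) ^ m ≤ ((1 + b ^ 2) * (t + 1)) ^ m := by gcongr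
    _ = (1 + b ^ 2) ^ m * (t + 1) ^ m := mul_pow _ _ _
    _ ≤ (1 + b ^ 2) ^ m * (2 ^ m * ∑ n ∈ Finset.range (m + 1), t ^ n) := by gcongr
    _ = _ := by
      rw [mul_pow]
      ring

/-! ### Norms as weighted integrals of the transform -/

section

variable {k b : ℝ} {M : Matrix.SpecialLinearGroup (Fin 2) ℝ}

theorem norm_sq_eq_integral (h : L2k k) : ‖h‖ ^ 2 = ∫ x, ‖h x‖ ^ 2 ∂(dunklMeasure k) := by
  have h1 := inner_self_eq_norm_sq_to_K (𝕜 := ℂ) h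
  rw [L2.inner_def] at h1
  have h2 : ∀ x, inner ℂ (h x) (h x) = ((‖h x‖ ^ 2 : ℝ) : ℂ) := fun x => by
    rw [inner_self_eq_norm_sq_to_K]
    push_cast
    rfl
  simp only [h2] at h1
  rw [integral_complex_ofReal] at h1
  exact Complex.ofReal_injective ((Complex.ofReal_pow _ _).trans h1.symm)

theorem norm_sq_power_mul (b : ℝ) (F : ℝ → ℂ) (n : ℕ) (x : ℝ) :
    ‖(Complex.I * ((x / b : ℝ) : ℂ)) ^ n * F x‖ ^ 2 = ((x / b) ^ 2) ^ n * ‖F x‖ ^ 2 := by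
  rw [norm_mul, norm_pow, norm_mul, Complex.norm_I, one_mul, Complex.norm_real, Real.norm_eq_abs,
    mul_pow, ← pow_mul, mul_comm n 2, pow_mul, sq_abs]

theorem memLp_power_mul_iff (F : L2k k) (n : ℕ) :
    MemLp (fun x : ℝ => (Complex.I * ((x / b : ℝ) : ℂ)) ^ n * F x) 2 (dunklMeasure k) ↔
      Integrable (fun x : ℝ => ((x / b) ^ 2) ^ n * ‖F x‖ ^ 2) (dunklMeasure k) := by
  rw [memLp_two_iff_integrable_sq_norm]
  · simp only [norm_sq_power_mul]
  · exact Continuous.aestronglyMeasurable (by fun_prop) |>.mul (Lp.aestronglyMeasurable F)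

theorem memLp_weight_mul_iff {g : ℝ → ℂ} (m : ℕ) (hg : AEStronglyMeasurable g (dunklMeasure k)) :
    MemLp (fun x : ℝ => (((1 + |x| ^ 2) ^ ((m : ℝ) / 2) : ℝ) : ℂ) * g x) 2 (dunklMeasure k) ↔
      Integrable (fun x : ℝ => (1 + x ^ 2) ^ m * ‖g x‖ ^ 2) (dunklMeasure k) := by
  rw [memLp_two_iff_integrable_sq_norm]
  · have h : ∀ x : ℝ, ‖(((1 + |x| ^ 2) ^ ((m : ℝ) / 2) : ℝ) : ℂ) * g x‖ ^ 2 =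
        (1 + x ^ 2) ^ m * ‖g x‖ ^ 2 := fun x => by
      have h0 : 0 ≤ 1 + x ^ 2 := by positivity
      rw [sq_abs, norm_mul, Complex.norm_real, Real.norm_of_nonneg (Real.rpow_nonneg h0 _),
        mul_pow, ← Real.rpow_mul_natCast h0]
      norm_num
    simp only [h]
  · exact (Measurable.aestronglyMeasurable (by fun_prop)).mul hg

theorem integrable_weight_iff (hb : b ≠ 0) (F : L2k k) (m : ℕ) :
    Integrable (fun x : ℝ => (1 + x ^ 2) ^ m * ‖F x‖ ^ 2) (dunklMeasure k) ↔
      ∀ n ≤ m, Integrable (fun x : ℝ => ((x / b) ^ 2) ^ n * ‖F x‖ ^ 2) (dunklMeasure k) := by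
  have hF : AEStronglyMeasurable (fun x => ‖F x‖ ^ 2) (dunklMeasure k) :=
    (Lp.aestronglyMeasurable F).norm.pow 2
  constructor
  · intro h n hn
    refine (h.const_mul ((1 + (b ^ 2)⁻¹) ^ m)).mono'
      ((Continuous.aestronglyMeasurable (by fun_prop)).mul hF)
      (Filter.Eventually.of_forall fun x => ?_)
    rw [Real.norm_of_nonneg (by positivity), ← mul_assoc]
    gcongr
    exact sq_div_pow_le b x hn
  · intro h
    have h1 := (integrable_finsetSum (Finset.range (m + 1)) fun n hn =>
      h n (Finset.mem_range_succ_iff.1 hn)).const_mul ((2 * (1 + b ^ 2)) ^ m)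
    refine h1.mono' ((Continuous.aestronglyMeasurable (by fun_prop)).mul hF)
      (Filter.Eventually.of_forall fun x => ?_)
    rw [Real.norm_of_nonneg (by positivity), ← Finset.sum_mul, ← mul_assoc]
    gcongr
    exact one_add_sq_pow_le hb x m

/-! ### The Sobolev spaces -/

theorem mem_spaceE_iff (hk : -1 / 2 ≤ k) (hb : M 0 1 ≠ 0) (m : ℕ) (f : L2k k) :
    f ∈ spaceE k M m ↔
      Integrable (fun x : ℝ => (1 + x ^ 2) ^ m * ‖lcL2 hk hb f x‖ ^ 2) (dunklMeasure k) := by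
  rw [integrable_weight_iff hb]
  refine forall₂_congr fun n _ => ?_
  rw [← memLp_power_mul_iff]
  constructor
  · rintro ⟨g, hg⟩
    exact (memLp_congr_ae ((isWeakPow_iff hk hb n f g).1 hg)).1 (Lp.memLp _)
  · intro h
    refine ⟨(lcL2 hk hb).symm (h.toLp _), (isWeakPow_iff hk hb n f _).2 ?_⟩
    rw [LinearIsometryEquiv.apply_symm_apply]
    exact h.coeFn_toLp

theorem sobolevSpace_eq (hk : -1 / 2 ≤ k) (hb : M 0 1 ≠ 0) (m : ℕ) :
    sobolevSpace k M m = toDist hk '' spaceE k M m := by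
  ext T
  constructor
  · rintro ⟨g, hg, hgm⟩
    -- Measurability is only given for the weighted function; dividing by the positive weight
    -- recovers it for $g$.
    have hgae : AEStronglyMeasurable g (dunklMeasure k) := by
      have h1 : ∀ x : ℝ, g x = (((1 + |x| ^ 2) ^ ((m : ℝ) / 2) : ℝ) : ℂ)⁻¹ *
          ((((1 + |x| ^ 2) ^ ((m : ℝ) / 2) : ℝ) : ℂ) * g x) := fun x => by
        rw [inv_mul_cancel_left₀]
        exact_mod_cast (Real.rpow_pos_of_pos (by positivity) _).ne'
      rw [funext h1]
      exact (Measurable.aestronglyMeasurable (by fun_prop)).mul hgm.aestronglyMeasurable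
    have hi := (memLp_weight_mul_iff m hgae).1 hgm
    -- The weight is at least $1$ because the order $m$ is nonnegative.
    have hg2 : MemLp g 2 (dunklMeasure k) := by
      rw [memLp_two_iff_integrable_sq_norm hgae]
      refine hi.mono' (hgae.norm.pow 2) (Filter.Eventually.of_forall fun x => ?_)
      rw [Real.norm_of_nonneg (by positivity)]
      exact le_mul_of_one_le_left (by positivity)
        (one_le_pow₀ (le_add_of_nonneg_right (sq_nonneg x)))
    refine ⟨_, (mem_spaceE_iff hk hb m _).2 ?_, (hg.eq_toDist hk hb hg2).symm⟩
    rw [LinearIsometryEquiv.apply_symm_apply]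
    refine hi.congr ?_
    filter_upwards [hg2.coeFn_toLp] with x hx
    rw [hx]
  · rintro ⟨f, hf, rfl⟩
    exact ⟨_, hasLCDT_toDist hk hb f,
      (memLp_weight_mul_iff m (Lp.aestronglyMeasurable _)).2 ((mem_spaceE_iff hk hb m f).1 hf)⟩

theorem norm_weakPow_sq (hk : -1 / 2 ≤ k) (hb : M 0 1 ≠ 0) {n : ℕ} {f : L2k k}
    (hf : ∃ g, IsWeakPow k M⁻¹ n f g) :
    ‖weakPow k M⁻¹ n f‖ ^ 2 =
      ∫ x : ℝ, ((x / M 0 1) ^ 2) ^ n * ‖lcL2 hk hb f x‖ ^ 2 ∂(dunklMeasure k) := by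
  have h : IsWeakPow k M⁻¹ n f (weakPow k M⁻¹ n f) := by
    rw [weakPow, dif_pos hf]
    exact hf.choose_spec
  rw [← (lcL2 hk hb).norm_map, norm_sq_eq_integral]
  refine integral_congr_ae ?_
  filter_upwards [(isWeakPow_iff hk hb n f _).1 h] with x hx
  rw [hx, norm_sq_power_mul]

theorem sobolevNorm_toDist_sq (hk : -1 / 2 ≤ k) (hb : M 0 1 ≠ 0) (m : ℕ) (f : L2k k) :
    sobolevNorm k M m (toDist hk f) ^ 2 =
      ∫ x : ℝ, (1 + x ^ 2) ^ m * ‖lcL2 hk hb f x‖ ^ 2 ∂(dunklMeasure k) := by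
  have hex : ∃ g, HasLCDT k M (toDist hk f) g := ⟨_, hasLCDT_toDist hk hb f⟩
  have h : HasLCDT k M (toDist hk f) (lcdtFun k M (toDist hk f)) := by
    rw [lcdtFun, dif_pos hex]
    exact hex.choose_spec
  have h1 : sobolevInner k M m (toDist hk f) (toDist hk f) =
      ((∫ x : ℝ, (1 + x ^ 2) ^ m * ‖lcL2 hk hb f x‖ ^ 2 ∂(dunklMeasure k) : ℝ) : ℂ) := by
    rw [sobolevInner, ← integral_complex_ofReal]
    refine integral_congr_ae ?_
    filter_upwards [h.ae_eq (hasLCDT_toDist hk hb f)] with x hx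
    rw [hx, mul_assoc, Complex.mul_conj, Complex.normSq_eq_norm_sq, sq_abs, Real.rpow_natCast]
    push_cast
    rfl
  rw [sobolevNorm, h1, Complex.ofReal_re, Real.sq_sqrt (integral_nonneg fun x => by positivity)]

theorem sum_norm_weakPow_sq (hk : -1 / 2 ≤ k) (hb : M 0 1 ≠ 0) {m : ℕ} {f : L2k k}
    (hf : f ∈ spaceE k M m) :
    ∑ n ∈ Finset.range (m + 1), ‖weakPow k M⁻¹ n f‖ ^ 2 =
      ∫ x : ℝ, (∑ n ∈ Finset.range (m + 1), ((x / M 0 1) ^ 2) ^ n) * ‖lcL2 hk hb f x‖ ^ 2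
        ∂(dunklMeasure k) := by
  have hi := (integrable_weight_iff hb _ m).1 ((mem_spaceE_iff hk hb m f).1 hf)
  simp only [Finset.sum_mul]
  rw [integral_finsetSum _ fun n hn => hi n (Finset.mem_range_succ_iff.1 hn)]
  exact Finset.sum_congr rfl fun n hn =>
    norm_weakPow_sq hk hb (hf n (Finset.mem_range_succ_iff.1 hn))

theorem sum_norm_weakPow_sq_le (hk : -1 / 2 ≤ k) (hb : M 0 1 ≠ 0) {m : ℕ} {f : L2k k}
    (hf : f ∈ spaceE k M m) :
    ∑ n ∈ Finset.range (m + 1), ‖weakPow k M⁻¹ n f‖ ^ 2 ≤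
      ((m + 1) * (1 + (M 0 1 ^ 2)⁻¹) ^ m) * sobolevNorm k M m (toDist hk f) ^ 2 := by
  rw [sum_norm_weakPow_sq hk hb hf, sobolevNorm_toDist_sq hk hb, ← integral_const_mul]
  refine integral_mono_of_nonneg (Filter.Eventually.of_forall fun x => ?_)
    (((mem_spaceE_iff hk hb m f).1 hf).const_mul _) (Filter.Eventually.of_forall fun x => ?_)
  · exact mul_nonneg (Finset.sum_nonneg fun n _ => by positivity) (by positivity)
  · simp only
    rw [← mul_assoc]
    gcongr
    calc ∑ n ∈ Finset.range (m + 1), ((x / M 0 1) ^ 2) ^ n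
        ≤ ∑ n ∈ Finset.range (m + 1), (1 + (M 0 1 ^ 2)⁻¹) ^ m * (1 + x ^ 2) ^ m :=
          Finset.sum_le_sum fun n hn => sq_div_pow_le _ x (Finset.mem_range_succ_iff.1 hn)
      _ = _ := by
        rw [Finset.sum_const, Finset.card_range, nsmul_eq_mul]
        push_cast
        ring

theorem sobolevNorm_sq_le (hk : -1 / 2 ≤ k) (hb : M 0 1 ≠ 0) {m : ℕ} {f : L2k k}
    (hf : f ∈ spaceE k M m) :
    sobolevNorm k M m (toDist hk f) ^ 2 ≤
      (2 * (1 + M 0 1 ^ 2)) ^ m * ∑ n ∈ Finset.range (m + 1), ‖weakPow k M⁻¹ n f‖ ^ 2 := by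
  have hi := (integrable_weight_iff hb _ m).1 ((mem_spaceE_iff hk hb m f).1 hf)
  rw [sum_norm_weakPow_sq hk hb hf, sobolevNorm_toDist_sq hk hb, ← integral_const_mul]
  refine integral_mono_of_nonneg (Filter.Eventually.of_forall fun x => by positivity)
    (Integrable.const_mul ?_ _) (Filter.Eventually.of_forall fun x => ?_)
  · simp only [Finset.sum_mul]
    exact integrable_finsetSum _ fun n hn => hi n (Finset.mem_range_succ_iff.1 hn)
  · simp only
    rw [← mul_assoc]
    gcongr
    exact one_add_sq_pow_le hb x m

end

end

end LCDunkl

theorem mainTheorem8 (m : ℕ) :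
    (∀ (k : ℝ) (hk : -1 / 2 ≤ k) (M : Matrix.SpecialLinearGroup (Fin 2) ℝ), M 0 1 ≠ 0 →
      LCDunkl.sobolevSpace k M m = LCDunkl.toDist hk '' LCDunkl.spaceE k M m) ∧
    (∀ b : ℝ, b ≠ 0 → ∃ c C : ℝ, 0 < c ∧ 0 < C ∧
      ∀ (k : ℝ) (hk : -1 / 2 ≤ k) (M : Matrix.SpecialLinearGroup (Fin 2) ℝ), M 0 1 = b →
        ∀ f ∈ LCDunkl.spaceE k M m,
          c * ∑ n ∈ Finset.range (m + 1), ‖LCDunkl.weakPow k M⁻¹ n f‖ ^ 2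
              ≤ LCDunkl.sobolevNorm k M m (LCDunkl.toDist hk f) ^ 2 ∧
          LCDunkl.sobolevNorm k M m (LCDunkl.toDist hk f) ^ 2
              ≤ C * ∑ n ∈ Finset.range (m + 1), ‖LCDunkl.weakPow k M⁻¹ n f‖ ^ 2) := by
  refine ⟨fun k hk M hb => LCDunkl.sobolevSpace_eq hk hb m, fun b hb => ?_⟩
  have hA : 0 < (m + 1) * (1 + (b ^ 2)⁻¹) ^ m := by positivity
  -- The lower constant inverts the bound for a sum of $m+1$ terms; the upper one is that of
  -- `one_add_sq_pow_le`. The order $k$ and the other entries of $M$ do not enter because the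
  -- transform is exactly isometric.
  refine ⟨((m + 1) * (1 + (b ^ 2)⁻¹) ^ m)⁻¹, (2 * (1 + b ^ 2)) ^ m, inv_pos.2 hA, by positivity, ?_⟩
  rintro k hk M rfl f hf
  exact ⟨(inv_mul_le_iff₀ hA).2 (LCDunkl.sum_norm_weakPow_sq_le hk hb hf),
    LCDunkl.sobolevNorm_sq_le hk hb hf⟩
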